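/- Call a countably infinite structure over a finite signature \emph{computable} if its domain is a computable subset of $\mathbb{N}$ and all its relations and functions are computable, and \emph{punctual} if its domain is $\mathbb{N}$ and all its relations and functions are primitive recursive. A class of structures is \emph{punctually robust} if every computable member of the class (in particular, infinite) is isomorphic to a punctual structure. The following classes of structures are not punctually robust: (i) join semilattices and meet semilattices; (ii) lattices, complemented lattices (bounded lattices in which every element has a complement), and non-distributive lattices (lattices in which the distributive law fails). This holds both when these structures are presented order-theoretically, as partial orders $(L,\le)$, and when they are presented algebraically, as $(L,\cup)$ for join semilattices, $(L,\cap)$ for meet semilattices, and $(L,\cup,\cap)$ for lattices, complemented lattices and non-distributive lattices. -/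

import Mathlib

namespace Punctual

open FirstOrder FirstOrder.Language FirstOrder.Language.Structure

/-! ### Computable structures, punctual structures, punctual robustness -/

/-- A structure over a finite signature `L` whose domain is the set `D` of natural numbers is
computable if `D` is infinite and computable, every function of the structure is the restriction
of a computable function on tuples of natural numbers, and every relation of the structure is
computable as a set of tuples of natural numbers. (The signature is finite, so computability is
automatically uniform in the symbols.) -/
structure IsComputableStructure (L : FirstOrder.Language.{0, 0}) [Finite L.Symbols]
    (D : Set ℕ) [L.Structure D] : Prop where
  infinite_dom : D.Infinite
  computable_dom : ComputablePred (fun n : ℕ => n ∈ D)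
  computable_fun : ∀ {n : ℕ} (f : L.Functions n),
    ∃ F : (Fin n → ℕ) → ℕ, Computable F ∧
      ∀ x : Fin n → D, F (fun i => (x i : ℕ)) = ((funMap f x : D) : ℕ)
  computable_rel : ∀ {n : ℕ} (R : L.Relations n),
    ComputablePred (fun x : Fin n → ℕ =>
      ∃ h : ∀ i, x i ∈ D, RelMap R (fun i => (⟨x i, h i⟩ : D)))

/-- A structure over a finite signature `L` with domain `ℕ` is punctual if all of its functions
and relations are primitive recursive. -/
structure IsPunctualStructure (L : FirstOrder.Language.{0, 0}) [Finite L.Symbols]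
    [L.Structure ℕ] : Prop where
  primrec_fun : ∀ {n : ℕ} (f : L.Functions n), Primrec (fun x : Fin n → ℕ => funMap f x)
  primrec_rel : ∀ {n : ℕ} (R : L.Relations n), PrimrecPred (fun x : Fin n → ℕ => RelMap R x)

/-- A structure is punctually presentable if it is isomorphic to a punctual one. -/
def PunctuallyPresentable (L : FirstOrder.Language.{0, 0}) [Finite L.Symbols]
    (M : Type) [L.Structure M] : Prop :=
  ∃ _ : L.Structure ℕ, IsPunctualStructure L ∧ Nonempty (M ≃[L] ℕ)

/-- A class `K` of `L`-structures is punctually robust if every computable member of `K` is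
punctually presentable. -/
def PunctuallyRobust (L : FirstOrder.Language.{0, 0}) [Finite L.Symbols]
    (K : (M : Type) → [L.Structure M] → Prop) : Prop :=
  ∀ (D : Set ℕ) [L.Structure D],
    IsComputableStructure L D → K D → PunctuallyPresentable L D

/-! ### The algebraic signatures

The order-theoretic signature, with the single binary relation symbol `≤`, is
`FirstOrder.Language.order`. -/

/-- The function symbols of the signature of semilattices: one binary operation. -/
inductive SemilatticeFunc : ℕ → Type
  | op : SemilatticeFunc 2

/-- The signature of algebraic join semilattices `(L, ∪)` and of algebraic meet semilattices
`(L, ∩)`. -/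
def semilatticeLang : FirstOrder.Language.{0, 0} := ⟨SemilatticeFunc, fun _ => Empty⟩

/-- The function symbols of the signature of lattices: two binary operations. -/
inductive LatticeFunc : ℕ → Type
  | join : LatticeFunc 2
  | meet : LatticeFunc 2

/-- The signature of algebraic lattices `(L, ∪, ∩)`. -/
def latticeLang : FirstOrder.Language.{0, 0} := ⟨LatticeFunc, fun _ => Empty⟩

/-- The operation symbol of `semilatticeLang`. -/
abbrev opSymb : semilatticeLang.Functions 2 := SemilatticeFunc.op

/-- The symbol for join in `latticeLang`. -/
abbrev joinSymb : latticeLang.Functions 2 := LatticeFunc.join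

/-- The symbol for meet in `latticeLang`. -/
abbrev meetSymb : latticeLang.Functions 2 := LatticeFunc.meet

instance instFiniteSymbolsSemilattice : Finite semilatticeLang.Symbols := by
  refine Finite.of_surjective (α := Unit) (fun _ => Sum.inl ⟨2, SemilatticeFunc.op⟩) ?_
  rintro (⟨n, ⟨⟩⟩ | ⟨n, ⟨⟩⟩)
  exact ⟨(), rfl⟩

instance instFiniteSymbolsLattice : Finite latticeLang.Symbols := by
  refine Finite.of_surjective (α := Bool) (fun b => Sum.inl
    ⟨2, bif b then LatticeFunc.join else LatticeFunc.meet⟩) ?_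
  rintro (⟨n, ⟨⟩ | ⟨⟩⟩ | ⟨n, ⟨⟩⟩)
  exacts [⟨true, rfl⟩, ⟨false, rfl⟩]

/-! ### Compatibility of a structure with an order or with lattice operations -/

/-- The relation of the structure `M` is the order `≤`. -/
def RelIsLE (M : Type) [Language.order.Structure M] [LE M] : Prop :=
  ∀ x y : M, RelMap (leSymb : Language.order.Relations 2) ![x, y] ↔ x ≤ y

/-- The operation of the structure `M` is the join. -/
def OpIsSup (M : Type) [semilatticeLang.Structure M] [SemilatticeSup M] : Prop :=
  ∀ x y : M, funMap opSymb ![x, y] = x ⊔ y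

/-- The operation of the structure `M` is the meet. -/
def OpIsInf (M : Type) [semilatticeLang.Structure M] [SemilatticeInf M] : Prop :=
  ∀ x y : M, funMap opSymb ![x, y] = x ⊓ y

/-- The two operations of the structure `M` are the join and the meet. -/
def OpsAreSupInf (M : Type) [latticeLang.Structure M] [Lattice M] : Prop :=
  ∀ x y : M, funMap joinSymb ![x, y] = x ⊔ y ∧ funMap meetSymb ![x, y] = x ⊓ y

/-- A lattice is complemented if it has a least and a greatest element and every element has a
complement. -/
def IsComplementedLattice (M : Type) [Lattice M] : Prop :=
  ∃ _ : BoundedOrder M, ComplementedLattice M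

/-- A lattice is non-distributive if the distributive law fails in it. -/
def IsNonDistributive (M : Type) [Lattice M] : Prop :=
  ¬ ∀ x y z : M, x ⊓ (y ⊔ z) = (x ⊓ y) ⊔ (x ⊓ z)

/-! ### The classes, as structures `(L, ≤)` -/

/-- Order-theoretic join semilattices. -/
def OrdJoinSemilattice (M : Type) [Language.order.Structure M] : Prop :=
  ∃ _ : SemilatticeSup M, RelIsLE M

/-- Order-theoretic meet semilattices. -/
def OrdMeetSemilattice (M : Type) [Language.order.Structure M] : Prop :=
  ∃ _ : SemilatticeInf M, RelIsLE M

/-- Order-theoretic lattices. -/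
def OrdLattice (M : Type) [Language.order.Structure M] : Prop :=
  ∃ _ : Lattice M, RelIsLE M

/-- Order-theoretic complemented lattices. -/
def OrdComplementedLattice (M : Type) [Language.order.Structure M] : Prop :=
  ∃ _ : Lattice M, RelIsLE M ∧ IsComplementedLattice M

/-- Order-theoretic non-distributive lattices. -/
def OrdNonDistributiveLattice (M : Type) [Language.order.Structure M] : Prop :=
  ∃ _ : Lattice M, RelIsLE M ∧ IsNonDistributive M

/-! ### The classes, as structures `(L, ∪)`, `(L, ∩)` and `(L, ∪, ∩)` -/

/-- Algebraic join semilattices. -/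
def AlgJoinSemilattice (M : Type) [semilatticeLang.Structure M] : Prop :=
  ∃ _ : SemilatticeSup M, OpIsSup M

/-- Algebraic meet semilattices. -/
def AlgMeetSemilattice (M : Type) [semilatticeLang.Structure M] : Prop :=
  ∃ _ : SemilatticeInf M, OpIsInf M

/-- Algebraic lattices `(L, ∪, ∩)` (lattices viewed as algebras). -/
def AlgLattice (M : Type) [latticeLang.Structure M] : Prop :=
  ∃ _ : Lattice M, OpsAreSupInf M

/-- Complemented lattices viewed as algebras `(L, ∪, ∩)`. -/
def AlgComplementedLattice (M : Type) [latticeLang.Structure M] : Prop :=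
  ∃ _ : Lattice M, OpsAreSupInf M ∧ IsComplementedLattice M

/-- Non-distributive lattices viewed as algebras `(L, ∪, ∩)`. -/
def AlgNonDistributiveLattice (M : Type) [latticeLang.Structure M] : Prop :=
  ∃ _ : Lattice M, OpsAreSupInf M ∧ IsNonDistributive M

end Punctual

/-! Search-free codes give a computable list, with total evaluation, of all primitive recursive
functions, so a computable structure can be built by diagonalising against every possible punctual
copy. Two constructions suffice.

The tower handles orders and single operations. It consists of two rows of points and intervals on
the number line, the lower row being allowed to lie below the upper one, ordered by "ends no later
than the other begins", with a top added. Upper intervals are all `[k, k + 2]`. The lower interval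
`n` begins at `2 * n`, and its right end is either fixed at a later stage or never. Whether it has
ended by a given position is decidable, so the order is computable, and so is the meet, which uses
only left ends. The interval `m + 1` is devoted to the `m`-th candidate copy. It stays open until a
finite configuration in the copy identifies some number `y` as this interval and shows `y` to be
below nothing, in a long initial segment, except itself and the top. Then it is closed, after which
too few elements fail to be above it (`Tower.card_not_above`), a contradiction. If no configuration
appears, the interval stays open and is covered by the top only, so its true configuration
(`Tower.detects`) would have been found. The configuration identifies `y` without knowledge of the
isomorphism (`Tower.eq_of_detects`), given the images of the top and two upper elements as
parameters. Interval `0` is never closed and serves as a complement.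

Joins in the tower reveal whether an interval ever ends, so `(L, ∪, ∩)` needs the comb. There a
lattice term in three parameters moves one step up a chain (`Comb.stepTerm_eq`), hence the chain of
any candidate copy can be computed without search. One bit `σ n` of the comb decides whether two
joins at height `3 * n` agree (`Comb.sup_teeth_iff`), and it is chosen to contradict the `n`-th
candidate. Both lattices are complemented and non-distributive. -/

namespace Punctual

open Nat.Partrec (Code)

/-! ### Closure properties of computable predicates -/

section Computability

variable {α β : Type*} [Primcodable α] [Primcodable β]

theorem _root_.ComputablePred.comp {p : β → Prop} (hp : ComputablePred p) {f : α → β}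
    (hf : Computable f) : ComputablePred fun a => p (f a) := by
  obtain ⟨_, h⟩ := hp
  exact ⟨fun a => inferInstance, h.comp hf⟩

theorem _root_.ComputablePred.and {p q : α → Prop} (hp : ComputablePred p)
    (hq : ComputablePred q) : ComputablePred fun a => p a ∧ q a := by
  obtain ⟨_, hp⟩ := hp
  obtain ⟨_, hq⟩ := hq
  exact ⟨fun a => inferInstance, (Primrec.and.to_comp.comp hp hq).of_eq fun a => by simp⟩

theorem _root_.ComputablePred.or {p q : α → Prop} (hp : ComputablePred p)
    (hq : ComputablePred q) : ComputablePred fun a => p a ∨ q a :=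
  ((hp.not.and hq.not).not).of_eq fun a => by tauto

theorem _root_.ComputablePred.imp {p q : α → Prop} (hp : ComputablePred p)
    (hq : ComputablePred q) : ComputablePred fun a => p a → q a :=
  ((hp.and hq.not).not).of_eq fun a => by tauto

theorem _root_.ComputablePred.forall_lt {p : α → ℕ → Prop}
    (hp : ComputablePred fun a : α × ℕ => p a.1 a.2) {f : α → ℕ} (hf : Computable f) :
    ComputablePred fun a => ∀ k < f a, p a k := by
  classical
  have hd := hp.decide
  let F : α → Bool := fun a =>
    Nat.rec (motive := fun _ => Bool) true (fun k acc => acc && decide (p a k)) (f a)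
  have hF : Computable F :=
    Computable.nat_rec (h := fun a (q : ℕ × Bool) => q.2 && decide (p a q.1)) hf
      (Computable.const true)
      (Primrec.and.to_comp.comp (Computable.snd.comp Computable.snd)
        (hd.comp (Computable.fst.pair (Computable.fst.comp Computable.snd)))).to₂
  have key : ∀ a, ∀ n, (Nat.rec (motive := fun _ => Bool) true
      (fun k acc => acc && decide (p a k)) n) = decide (∀ k < n, p a k) := by
    intro a n
    induction n with
    | zero => simp
    | succ n ih => simp only [ih, Nat.forall_lt_succ_right, Bool.decide_and]
  exact ⟨fun a => Classical.propDecidable _, hF.of_eq fun a => by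
    simp only [F, key]
    congr⟩

theorem _root_.ComputablePred.exists_lt {p : α → ℕ → Prop}
    (hp : ComputablePred fun a : α × ℕ => p a.1 a.2) {f : α → ℕ} (hf : Computable f) :
    ComputablePred fun a => ∃ k < f a, p a k :=
  (ComputablePred.forall_lt (p := fun a k => ¬ p a k) hp.not hf).not.of_eq fun a => by
    push Not; rfl

theorem _root_.Computable.ite {p : α → Prop} [DecidablePred p] (hp : ComputablePred p)
    {f g : α → β} (hf : Computable f) (hg : Computable g) :
    Computable fun a => if p a then f a else g a :=
  (Computable.cond hp.decide hf hg).of_eq fun a => by by_cases h : p a <;> simp [h]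

theorem _root_.ComputablePred.eq [DecidableEq β] {f g : α → β} (hf : Computable f)
    (hg : Computable g) : ComputablePred fun a => f a = g a :=
  Computable.computablePred (Primrec.eq.decide.to_comp.comp hf hg)

theorem _root_.ComputablePred.nat_le {f g : α → ℕ} (hf : Computable f)
    (hg : Computable g) : ComputablePred fun a => f a ≤ g a :=
  Computable.computablePred (Primrec.nat_le.decide.to_comp.comp hf hg)

end Computability

/-! ### A computable enumeration of the primitive recursive functions -/

/-- The codes of partial recursive functions that do not use unbounded search. -/
def searchFree (c : Code) : Bool :=
  Code.recOn c true true true true (fun _ _ a b => a && b) (fun _ _ a b => a && b)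
    (fun _ _ a b => a && b) (fun _ _ => false)

theorem computable_searchFree : Computable searchFree := by
  have h : Computable₂ fun (_ : Code) (p : Code × Code × Bool × Bool) => p.2.2.1 && p.2.2.2 :=
    (Primrec.and.comp
      (Primrec.fst.comp (Primrec.snd.comp (Primrec.snd.comp Primrec.snd)))
      (Primrec.snd.comp (Primrec.snd.comp (Primrec.snd.comp Primrec.snd)))).to_comp.to₂
  exact Code.computable_recOn (c := id) Computable.id (Computable.const true)
    (Computable.const true) (Computable.const true) (Computable.const true) h h h
    (rf := fun _ _ => false) (Computable.const false).to₂

/-- Only `rfind'` can diverge. For `prec`, totality needs a second induction, on the recursion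
argument. -/
theorem eval_dom_of_searchFree : ∀ {c : Code}, searchFree c → ∀ n, (c.eval n).Dom
  | .zero, _, n => trivial
  | .succ, _, n => trivial
  | .left, _, n => trivial
  | .right, _, n => trivial
  | .pair f g, h, n => by
    have h : searchFree f && searchFree g := h
    rw [Bool.and_eq_true] at h
    have hf := eval_dom_of_searchFree h.1 n
    have hg := eval_dom_of_searchFree h.2 n
    simp [Code.eval, Seq.seq, hf, hg]
  | .comp f g, h, n => by
    have h : searchFree f && searchFree g := h
    rw [Bool.and_eq_true] at h
    have hg := eval_dom_of_searchFree h.2 n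
    simp only [Code.eval]
    exact ⟨hg, eval_dom_of_searchFree h.1 _⟩
  | .prec f g, h, n => by
    have h : searchFree f && searchFree g := h
    rw [Bool.and_eq_true] at h
    obtain ⟨a, k, rfl⟩ : ∃ a k, n = Nat.pair a k := ⟨_, _, (Nat.pair_unpair n).symm⟩
    induction k with
    | zero => rw [Code.eval_prec_zero]; exact eval_dom_of_searchFree h.1 a
    | succ k ih => rw [Code.eval_prec_succ]; exact ⟨ih, eval_dom_of_searchFree h.2 _⟩
  | .rfind' f, h, n => by cases h

/-- The function computed by a search-free code (and `0` on the other codes). -/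
def primEval (c : Code) (n : ℕ) : ℕ :=
  if h : searchFree c then (c.eval n).get (eval_dom_of_searchFree h n) else 0

theorem computable_primEval : Computable₂ primEval := by
  have h : Partrec fun p : Code × ℕ => bif searchFree p.1 then p.1.eval p.2 else Part.some 0 :=
    Partrec.cond (computable_searchFree.comp Computable.fst)
      (Code.eval_part.comp Computable.fst Computable.snd) (Computable.const 0)
  refine h.of_eq_tot fun p => ?_
  by_cases hp : searchFree p.1
  · simp only [primEval, hp, dite_true, cond_true]
    exact Part.get_mem _
  · simp [primEval, hp]

theorem exists_code_of_primrec {f : ℕ → ℕ} (hf : Nat.Primrec f) :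
    ∃ c : Code, searchFree c ∧ ∀ n, c.eval n = Part.some (f n) := by
  induction hf with
  | zero => exact ⟨.zero, rfl, fun n => rfl⟩
  | succ => exact ⟨.succ, rfl, fun n => rfl⟩
  | left => exact ⟨.left, rfl, fun n => rfl⟩
  | right => exact ⟨.right, rfl, fun n => rfl⟩
  | pair _ _ ihf ihg =>
    obtain ⟨c, hc, ec⟩ := ihf
    obtain ⟨d, hd, ed⟩ := ihg
    exact ⟨.pair c d, by simpa [searchFree] using And.intro hc hd, fun n => by
      simp [Code.eval, ec, ed, Seq.seq]⟩
  | comp _ _ ihf ihg =>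
    obtain ⟨c, hc, ec⟩ := ihf
    obtain ⟨d, hd, ed⟩ := ihg
    exact ⟨.comp c d, by simpa [searchFree] using And.intro hc hd, fun n => by
      simp only [Code.eval, ed]
      exact (Part.bind_some _ _).trans (ec _)⟩
  | @prec f g _ _ ihf ihg =>
    obtain ⟨c, hc, ec⟩ := ihf
    obtain ⟨d, hd, ed⟩ := ihg
    refine ⟨.prec c d, by simpa [searchFree] using And.intro hc hd, fun n => ?_⟩
    obtain ⟨a, k, rfl⟩ : ∃ a k, n = Nat.pair a k := ⟨_, _, (Nat.pair_unpair n).symm⟩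
    induction k with
    | zero => simp [Code.eval_prec_zero, ec]
    | succ k ih => rw [Code.eval_prec_succ, ih]; simp [ed]

theorem exists_primEval_eq {f : ℕ → ℕ} (hf : Nat.Primrec f) : ∃ c, ∀ n, primEval c n = f n := by
  obtain ⟨c, hc, h⟩ := exists_code_of_primrec hf
  exact ⟨c, fun n => by simp [primEval, hc, h]⟩

/-- The binary functions enumerated by `primEval`. -/
def primEval₂ (c : Code) (a b : ℕ) : ℕ := primEval c (Nat.pair a b)

theorem computable_primEval₂ :
    Computable fun p : Code × ℕ × ℕ => primEval₂ p.1 p.2.1 p.2.2 :=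
  computable_primEval.comp Computable.fst (Primrec₂.natPair.to_comp.comp
    (Computable.fst.comp Computable.snd) (Computable.snd.comp Computable.snd))

theorem exists_primEval₂_eq {f : ℕ → ℕ → ℕ} (hf : Primrec₂ f) :
    ∃ c, ∀ a b, primEval₂ c a b = f a b := by
  obtain ⟨c, hc⟩ := exists_primEval_eq (Primrec₂.unpaired'.2 hf)
  exact ⟨c, fun a b => by simp [primEval₂, hc]⟩

end Punctual

namespace Punctual
open FirstOrder FirstOrder.Language FirstOrder.Language.Structure Encodable

/-! ### Passing from a computable encodable structure to a punctual copy -/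

section Presentations

variable (A : Type) [Primcodable A]

/-- The copy of an encodable type as a set of natural numbers. -/
abbrev codeSet : Set ℕ := Set.range (encode : A → ℕ)

/-- The decoding bijection. -/
noncomputable def codeEquiv : codeSet A ≃ A := (Equiv.ofInjective encode encode_injective).symm

variable {A}

@[simp] theorem codeEquiv_encode (a : A) (h : encode a ∈ codeSet A) :
    codeEquiv A ⟨encode a, h⟩ = a :=
  (codeEquiv A).symm.injective (by simp only [Equiv.symm_apply_apply]; rfl)

theorem coe_codeEquiv_symm (a : A) : ((codeEquiv A).symm a : ℕ) = encode a := rfl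

theorem encode_codeEquiv (x : codeSet A) : encode (codeEquiv A x) = x := by
  rw [← coe_codeEquiv_symm, Equiv.symm_apply_apply]

theorem computablePred_mem_codeSet : ComputablePred fun n : ℕ => n ∈ codeSet A :=
  Primcodable.mem_range_encode.computablePred

theorem infinite_codeSet [Infinite A] : (codeSet A).Infinite :=
  Set.infinite_range_of_injective encode_injective

/-- Values off the code set are irrelevant, so plain `decode` with default `0` is enough. -/
theorem exists_computable_extension {op : A → A → A} (hop : Computable₂ op) :
    ∃ F : (Fin 2 → ℕ) → ℕ, Computable F ∧ ∀ x : Fin 2 → codeSet A,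
      F (fun i => (x i : ℕ)) = encode (op (codeEquiv A (x 0)) (codeEquiv A (x 1))) := by
  let F : (Fin 2 → ℕ) → ℕ := fun x =>
    (((decode (α := A) (x 0)).bind fun a => (decode (α := A) (x 1)).map fun b =>
      encode (op a b)).getD 0)
  have h0 : ∀ i : Fin 2, Computable fun x : Fin 2 → ℕ => x i := fun i =>
    Computable.fin_app.comp Computable.id (Computable.const i)
  refine ⟨F, Computable.option_getD (Computable.option_bind (Computable.decode.comp (h0 0))
    (Computable.option_map (Computable.decode.comp ((h0 1).comp Computable.fst))
      (Computable.encode.comp (hop.comp (Computable.snd.comp Computable.fst)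
        Computable.snd)).to₂).to₂) (Computable.const 0), fun x => ?_⟩
  simp only [F, ← encode_codeEquiv, encodek, Option.bind_some, Option.map_some, Option.getD_some]

theorem _root_.Primrec.vec_two : Primrec fun p : ℕ × ℕ => ![p.1, p.2] :=
  Primrec.fin_curry.2 <| Primrec₂.comp (f := fun (i : Fin 2) (p : ℕ × ℕ) => ![p.1, p.2] i)
    (Primrec.fin_curry₁.2 <| Fin.forall_fin_two.2 ⟨Primrec.fst, Primrec.snd⟩)
    Primrec.snd Primrec.fst

theorem comp_vec_two {M N : Type*} (f : M → N) (x y : M) : f ∘ ![x, y] = ![f x, f y] := by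
  funext i
  fin_cases i <;> rfl

/-- The relation must fail off the code set. As `decode` may succeed on numbers that are not codes,
`decode₂` is used instead. -/
theorem computablePred_extension {R : A → A → Prop} (hR : ComputablePred fun p : A × A => R p.1 p.2) :
    ComputablePred fun x : Fin 2 → ℕ => ∃ h : ∀ i, x i ∈ codeSet A,
      R (codeEquiv A ⟨x 0, h 0⟩) (codeEquiv A ⟨x 1, h 1⟩) := by
  classical
  have h0 : ∀ i : Fin 2, Computable fun x : Fin 2 → ℕ => x i := fun i =>
    Computable.fin_app.comp Computable.id (Computable.const i)
  have hc : Computable fun x : Fin 2 → ℕ =>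
      ((decode₂ A (x 0)).bind fun a => (decode₂ A (x 1)).map fun b =>
        decide (R a b)).getD false :=
    Computable.option_getD (Computable.option_bind (Primrec.decode₂.to_comp.comp (h0 0))
      (Computable.option_map (Primrec.decode₂.to_comp.comp ((h0 1).comp Computable.fst))
        (hR.decide.comp ((Computable.snd.comp Computable.fst).pair
          Computable.snd)).to₂).to₂) (Computable.const false)
  refine (ComputablePred.computable_iff.2 ⟨_, hc, rfl⟩).of_eq fun x => ?_
  constructor
  · intro h
    rcases h1 : decode₂ A (x 0) with _ | a
    · simp [h1] at h
    rcases h2 : decode₂ A (x 1) with _ | b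
    · simp [h1, h2] at h
    simp only [h1, h2, Option.bind_some, Option.map_some, Option.getD_some,
      decide_eq_true_eq] at h
    rw [decode₂_eq_some] at h1 h2
    refine ⟨Fin.forall_fin_two.2 ⟨⟨a, h1⟩, ⟨b, h2⟩⟩, ?_⟩
    simpa only [← h1, ← h2, codeEquiv_encode] using h
  · rintro ⟨hx, h⟩
    obtain ⟨a, ha⟩ := hx 0
    obtain ⟨b, hb⟩ := hx 1
    simp only [← ha, ← hb, codeEquiv_encode] at h
    simpa only [← ha, ← hb, decode₂_encode, Option.bind_some, Option.map_some, Option.getD_some,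
      decide_eq_true_eq] using h

/-- If the class `K` of orders is punctually robust and all isomorphic copies of the computable
order `A` are in `K`, then `A` has a primitive recursive copy. -/
theorem PunctuallyRobust.exists_primrecRel [Infinite A] [LE A]
    (hle : ComputablePred fun p : A × A => p.1 ≤ p.2)
    {K : (M : Type) → [Language.order.Structure M] → Prop}
    (hK : PunctuallyRobust Language.order K)
    (hKA : ∀ (D : Type) [Language.order.Structure D] (e : D ≃ A),
      (∀ x y, RelMap (leSymb : Language.order.Relations 2) ![x, y] ↔ e x ≤ e y) → K D) :
    ∃ r : ℕ → ℕ → Prop, PrimrecRel r ∧ ∃ f : A ≃ ℕ, ∀ x y, x ≤ y ↔ r (f x) (f y) := by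
  let : Language.order.Structure (codeSet A) :=
    { funMap := fun f => f.elim
      RelMap := fun {n} R => match n, R with
        | _, .le => fun x => codeEquiv A (x 0) ≤ codeEquiv A (x 1) }
  have hrel : ∀ x : Fin 2 → codeSet A, RelMap (leSymb : Language.order.Relations 2) x ↔
      codeEquiv A (x 0) ≤ codeEquiv A (x 1) := fun x => Iff.rfl
  have hcomp : IsComputableStructure Language.order (codeSet A) := by
    refine ⟨infinite_codeSet, computablePred_mem_codeSet, fun f => f.elim, ?_⟩
    rintro n ⟨⟩
    exact computablePred_extension hle
  obtain ⟨S, hS, ⟨φ⟩⟩ := hK (codeSet A) hcomp (hKA _ (codeEquiv A) fun x y => hrel ![x, y])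
  refine ⟨fun a b => RelMap (leSymb : Language.order.Relations 2) ![a, b], ?_,
    (codeEquiv A).symm.trans φ.toEquiv, fun x y => ?_⟩
  · exact (hS.primrec_rel leSymb).comp Primrec.vec_two
  · have := φ.map_rel leSymb ![(codeEquiv A).symm x, (codeEquiv A).symm y]
    rw [hrel, comp_vec_two] at this
    exact (by simpa using this.symm : x ≤ y ↔ RelMap leSymb
      ![φ ((codeEquiv A).symm x), φ ((codeEquiv A).symm y)])

/-- If the class `K` is punctually robust and all isomorphic copies of `A` with the computable
operation `op` are in `K`, then `(A, op)` has a primitive recursive copy. -/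
theorem PunctuallyRobust.exists_primrec_op [Infinite A] {op : A → A → A} (hop : Computable₂ op)
    {K : (M : Type) → [semilatticeLang.Structure M] → Prop}
    (hK : PunctuallyRobust semilatticeLang K)
    (hKA : ∀ (D : Type) [semilatticeLang.Structure D] (e : D ≃ A),
      (∀ x y, e (funMap opSymb ![x, y]) = op (e x) (e y)) → K D) :
    ∃ g : ℕ → ℕ → ℕ, Primrec₂ g ∧ ∃ f : A ≃ ℕ, ∀ x y, f (op x y) = g (f x) (f y) := by
  let : semilatticeLang.Structure (codeSet A) :=
    { funMap := fun {n} F => match n, F with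
        | _, .op => fun x => (codeEquiv A).symm (op (codeEquiv A (x 0)) (codeEquiv A (x 1)))
      RelMap := fun R => R.elim }
  have hfun : ∀ x : Fin 2 → codeSet A, funMap opSymb x =
      (codeEquiv A).symm (op (codeEquiv A (x 0)) (codeEquiv A (x 1))) := fun x => rfl
  have hcomp : IsComputableStructure semilatticeLang (codeSet A) := by
    refine ⟨infinite_codeSet, computablePred_mem_codeSet, ?_, fun R => R.elim⟩
    rintro n ⟨⟩
    exact exists_computable_extension hop
  obtain ⟨S, hS, ⟨φ⟩⟩ := hK (codeSet A) hcomp (hKA _ (codeEquiv A) fun x y => by simp [hfun])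
  refine ⟨fun a b => funMap opSymb ![a, b], ?_, (codeEquiv A).symm.trans φ.toEquiv, fun x y => ?_⟩
  · exact (hS.primrec_fun opSymb).comp Primrec.vec_two
  · have := φ.map_fun opSymb ![(codeEquiv A).symm x, (codeEquiv A).symm y]
    rw [hfun, comp_vec_two] at this
    exact (by simpa using this : φ ((codeEquiv A).symm (op x y)) = funMap opSymb
      ![φ ((codeEquiv A).symm x), φ ((codeEquiv A).symm y)])

/-- If the class `K` is punctually robust and all isomorphic copies of `A` with two computable
operations are in `K`, then `A` has a primitive recursive copy. -/
theorem PunctuallyRobust.exists_primrec_ops [Infinite A] {sup inf : A → A → A}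
    (hsup : Computable₂ sup) (hinf : Computable₂ inf)
    {K : (M : Type) → [latticeLang.Structure M] → Prop}
    (hK : PunctuallyRobust latticeLang K)
    (hKA : ∀ (D : Type) [latticeLang.Structure D] (e : D ≃ A),
      (∀ x y, e (funMap joinSymb ![x, y]) = sup (e x) (e y) ∧
        e (funMap meetSymb ![x, y]) = inf (e x) (e y)) → K D) :
    ∃ g h : ℕ → ℕ → ℕ, Primrec₂ g ∧ Primrec₂ h ∧ ∃ f : A ≃ ℕ,
      ∀ x y, f (sup x y) = g (f x) (f y) ∧ f (inf x y) = h (f x) (f y) := by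
  let : latticeLang.Structure (codeSet A) :=
    { funMap := fun {n} F => match n, F with
        | _, .join => fun x => (codeEquiv A).symm (sup (codeEquiv A (x 0)) (codeEquiv A (x 1)))
        | _, .meet => fun x => (codeEquiv A).symm (inf (codeEquiv A (x 0)) (codeEquiv A (x 1)))
      RelMap := fun R => R.elim }
  have hjoin : ∀ x : Fin 2 → codeSet A, funMap joinSymb x =
      (codeEquiv A).symm (sup (codeEquiv A (x 0)) (codeEquiv A (x 1))) := fun x => rfl
  have hmeet : ∀ x : Fin 2 → codeSet A, funMap meetSymb x =
      (codeEquiv A).symm (inf (codeEquiv A (x 0)) (codeEquiv A (x 1))) := fun x => rfl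
  have hcomp : IsComputableStructure latticeLang (codeSet A) := by
    refine ⟨infinite_codeSet, computablePred_mem_codeSet, ?_, fun R => R.elim⟩
    rintro n (⟨⟩ | ⟨⟩)
    · exact exists_computable_extension hsup
    · exact exists_computable_extension hinf
  obtain ⟨S, hS, ⟨φ⟩⟩ := hK (codeSet A) hcomp
    (hKA _ (codeEquiv A) fun x y => by simp [hjoin, hmeet])
  refine ⟨fun a b => funMap joinSymb ![a, b], fun a b => funMap meetSymb ![a, b],
    (hS.primrec_fun joinSymb).comp Primrec.vec_two, (hS.primrec_fun meetSymb).comp Primrec.vec_two,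
    (codeEquiv A).symm.trans φ.toEquiv, fun x y => ⟨?_, ?_⟩⟩
  · have := φ.map_fun joinSymb ![(codeEquiv A).symm x, (codeEquiv A).symm y]
    rw [hjoin, comp_vec_two] at this
    exact (by simpa using this : φ ((codeEquiv A).symm (sup x y)) = funMap joinSymb
      ![φ ((codeEquiv A).symm x), φ ((codeEquiv A).symm y)])
  · have := φ.map_fun meetSymb ![(codeEquiv A).symm x, (codeEquiv A).symm y]
    rw [hmeet, comp_vec_two] at this
    exact (by simpa using this : φ ((codeEquiv A).symm (inf x y)) = funMap meetSymb
      ![φ ((codeEquiv A).symm x), φ ((codeEquiv A).symm y)])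

end Presentations

/-- The lattice structure transported along a bijection. -/
abbrev _root_.Equiv.pullbackLattice {D A : Type*} [Lattice A] (e : D ≃ A) : Lattice D :=
  letI : LE D := ⟨fun x y => e x ≤ e y⟩
  letI : LT D := ⟨fun x y => e x < e y⟩
  letI : Max D := ⟨fun x y => e.symm (e x ⊔ e y)⟩
  letI : Min D := ⟨fun x y => e.symm (e x ⊓ e y)⟩
  e.injective.lattice e Iff.rfl Iff.rfl (fun _ _ => e.apply_symm_apply _)
    (fun _ _ => e.apply_symm_apply _)

theorem isComplementedLattice_pullback {D A : Type} [Lattice A] (e : D ≃ A)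
    (h : IsComplementedLattice A) : @IsComplementedLattice D e.pullbackLattice := by
  obtain ⟨_, _⟩ := h
  let := e.pullbackLattice
  let o : D ≃o A := ⟨e, Iff.rfl⟩
  let : BoundedOrder D :=
    { top := o.symm ⊤, bot := o.symm ⊥
      le_top := fun a => (o.le_symm_apply).2 le_top
      bot_le := fun a => (o.symm_apply_le).2 bot_le }
  exact ⟨this, o.symm.complementedLattice⟩

theorem isNonDistributive_pullback {D A : Type} [Lattice A] (e : D ≃ A)
    (h : IsNonDistributive A) : @IsNonDistributive D e.pullbackLattice := by
  let := e.pullbackLattice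
  let o : D ≃o A := ⟨e, Iff.rfl⟩
  intro hd
  refine h fun x y z => o.symm.injective ?_
  simp only [map_inf, map_sup]
  exact hd _ _ _

end Punctual

namespace Punctual

/-! ### The tower lattices -/

/-- A monotone family of stages at which the intervals of a tower are closed. -/
structure Schedule where
  /-- the `n`-th interval is closed by stage `k` -/
  closed : ℕ → ℕ → Prop
  mono : ∀ {n k l}, closed n k → k ≤ l → closed n l
  lt : ∀ {n k}, closed n k → n < k
  zero : ∀ k, ¬ closed 0 k

/-- The tower with intervals closed according to `T`. Its elements are a greatest element and
triples `(b, g, k)`, where `b` is the side of the tower, and `g` tells intervals from points. -/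
def Tower (_ : Schedule) : Type := Option (Bool × Bool × ℕ)

namespace Tower

variable {T : Schedule}

instance : Primcodable (Tower T) := inferInstanceAs (Primcodable (Option (Bool × Bool × ℕ)))

instance : Infinite (Tower T) := inferInstanceAs (Infinite (Option (Bool × Bool × ℕ)))

/-- The element of the tower with the given parameters. -/
def elem (T : Schedule) (b g : Bool) (k : ℕ) : Tower T := some (b, g, k)

theorem elem_injective {b g b' g' : Bool} {k k' : ℕ} :
    elem T b g k = elem T b' g' k' ↔ b = b' ∧ g = g' ∧ k = k' :=
  (Option.some_inj (a := (b, g, k)) (b := (b', g', k'))).trans (by simp)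

/-- The left end of an element. -/
def left (v : Bool × Bool × ℕ) : ℕ := bif v.2.1 && !v.1 then 2 * v.2.2 else v.2.2

/-- The right end of an element is at most `j`. -/
def EndsBy (T : Schedule) (v : Bool × Bool × ℕ) (j : ℕ) : Prop :=
  (v.2.1 = false ∧ v.2.2 ≤ j) ∨ (v.2.1 = true ∧ v.1 = true ∧ v.2.2 + 2 ≤ j) ∨
    (v.2.1 = true ∧ v.1 = false ∧ T.closed v.2.2 (j / 2))

theorem EndsBy.mono {v : Bool × Bool × ℕ} {i j : ℕ} (h : EndsBy T v i) (hij : i ≤ j) :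
    EndsBy T v j := by
  rcases h with ⟨h, h'⟩ | ⟨h, h', h''⟩ | ⟨h, h', h''⟩
  · exact Or.inl ⟨h, h'.trans hij⟩
  · exact Or.inr (Or.inl ⟨h, h', h''.trans hij⟩)
  · exact Or.inr (Or.inr ⟨h, h', T.mono h'' (Nat.div_le_div_right hij)⟩)

theorem EndsBy.left_le {v : Bool × Bool × ℕ} {j : ℕ} (h : EndsBy T v j) : left v ≤ j := by
  obtain ⟨b, g, k⟩ := v
  rcases h with ⟨h, h'⟩ | ⟨h, h', h''⟩ | ⟨h, h', h''⟩ <;> simp only at h h' <;> subst h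
  · simpa [left] using h'
  · subst h'; simp only [left]; simp at h'' ⊢; omega
  · subst h'
    have := T.lt h''
    simp only [left]; simp at this ⊢; omega

/-- Wide intervals have length two and lower intervals close only at a stage beyond their index, so
only points end where they begin. Antisymmetry of the order rests on this. -/
theorem EndsBy.isPoint {v : Bool × Bool × ℕ} (h : EndsBy T v (left v)) : v.2.1 = false := by
  obtain ⟨b, g, k⟩ := v
  rcases h with ⟨h, h'⟩ | ⟨h, h', h''⟩ | ⟨h, h', h''⟩ <;> simp only at h h' <;> subst h
  · rfl
  · subst h'; simp [left] at h''
  · subst h'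
    have := T.lt h''
    simp [left] at this

theorem endsBy_point {b : Bool} {k j : ℕ} : EndsBy T (b, false, k) j ↔ k ≤ j := by
  simp [EndsBy]

theorem endsBy_wide {k j : ℕ} : EndsBy T (true, true, k) j ↔ k + 2 ≤ j := by
  simp [EndsBy]

theorem endsBy_interval {k j : ℕ} : EndsBy T (false, true, k) j ↔ T.closed k (j / 2) := by
  simp [EndsBy]

/-- An interval order: an element other than the top lies below a different one when it ends no
later than the other begins and is not on a higher side. Transitivity holds because nothing begins
after its own end. -/
instance : PartialOrder (Tower T) where
  le x y := Option.casesOn (motive := fun _ => Prop) y True fun w =>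
    Option.casesOn (motive := fun _ => Prop) x False fun v =>
      v = w ∨ (v.1 ≤ w.1 ∧ EndsBy T v (left w))
  le_refl x := by
    rcases x with _ | v
    · trivial
    · exact Or.inl rfl
  le_trans x y z hxy hyz := by
    rcases z with _ | c
    · trivial
    rcases y with _ | b
    · exact hyz.elim
    rcases x with _ | a
    · exact hxy.elim
    rcases hxy with rfl | hab
    · exact hyz
    rcases hyz with rfl | hbc
    · exact Or.inr hab
    · exact Or.inr ⟨hab.1.trans hbc.1, hab.2.mono hbc.2.left_le⟩
  le_antisymm x y hxy hyx := by
    rcases x with _ | a <;> rcases y with _ | b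
    · rfl
    · exact hxy.elim
    · exact hyx.elim
    · rcases hxy with rfl | hab
      · rfl
      rcases hyx with rfl | hba
      · rfl
      have h1 := hab.2.left_le
      have h2 := hba.2.left_le
      have h3 : left a = left b := le_antisymm h1 h2
      have ha := (h3 ▸ hab.2 : EndsBy T a (left a)).isPoint
      have hb := (h3.symm ▸ hba.2 : EndsBy T b (left b)).isPoint
      obtain ⟨a1, a2, a3⟩ := a
      obtain ⟨b1, b2, b3⟩ := b
      simp only at ha hb
      subst ha hb
      have h5 : a1 = b1 := le_antisymm hab.1 hba.1
      have h4 : a3 = b3 := by simpa [left] using h3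
      rw [h4, h5]

instance : OrderTop (Tower T) where
  top := none
  le_top _ := trivial

theorem elem_le_elem {v w : Bool × Bool × ℕ} :
    elem T v.1 v.2.1 v.2.2 ≤ elem T w.1 w.2.1 w.2.2 ↔
      v = w ∨ (v.1 ≤ w.1 ∧ EndsBy T v (left w)) := Iff.rfl

theorem eq_top_or_elem (x : Tower T) : x = ⊤ ∨ ∃ b g k, x = elem T b g k := by
  rcases x with _ | ⟨b, g, k⟩
  · exact Or.inl rfl
  · exact Or.inr ⟨b, g, k, rfl⟩

instance : OrderBot (Tower T) where
  bot := elem T false false 0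
  bot_le x := by
    rcases x with _ | v
    · trivial
    · exact Or.inr ⟨Bool.false_le _, Or.inl ⟨rfl, Nat.zero_le _⟩⟩

/-- The point at the left ends of two elements. -/
def leftPoint (x y : Tower T) : Tower T :=
  Option.bind (α := Bool × Bool × ℕ) (β := Bool × Bool × ℕ) x fun v =>
    Option.map (fun w : Bool × Bool × ℕ => (v.1 && w.1, false, min (left v) (left w))) y

open scoped Classical in
/-- The point at the right ends of two elements. -/
noncomputable def rightPoint (x y : Tower T) : Tower T :=
  Option.bind (α := Bool × Bool × ℕ) (β := Bool × Bool × ℕ) x fun v =>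
    Option.bind (α := Bool × Bool × ℕ) (β := Bool × Bool × ℕ) y fun w =>
      if h : ∃ j, EndsBy T v j ∧ EndsBy T w j then some (v.1 || w.1, false, Nat.find h) else none

/-- A common lower bound of incomparable elements differs from both, so it ends no later than either
of them begins. -/
theorem isGLB_leftPoint {x y : Tower T} (hxy : ¬ x ≤ y) (hyx : ¬ y ≤ x) :
    IsGLB {x, y} (leftPoint x y) := by
  rcases x with _ | v
  · exact (hyx trivial).elim
  rcases y with _ | w
  · exact (hxy trivial).elim
  constructor
  · rintro _ (rfl | rfl)
    · exact Or.inr ⟨Bool.and_le_left _ _, endsBy_point.2 (min_le_left _ _)⟩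
    · exact Or.inr ⟨Bool.and_le_right _ _, endsBy_point.2 (min_le_right _ _)⟩
  · intro z hz
    have hzx : z ≤ some v := hz (Or.inl rfl)
    have hzy : z ≤ some w := hz (Or.inr rfl)
    rcases z with _ | a
    · exact hzx.elim
    rcases hzx with rfl | hzx
    · exact (hxy hzy).elim
    rcases hzy with rfl | hzy
    · exact (hyx (Or.inr hzx)).elim
    refine Or.inr ⟨Bool.le_and hzx.1 hzy.1, ?_⟩
    have h : left (v.1 && w.1, false, min (left v) (left w)) = min (left v) (left w) := by
      simp [left]
    rw [h]
    rcases min_choice (left v) (left w) with h | h <;> rw [h]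
    exacts [hzx.2, hzy.2]

/-- A common upper bound differs from both elements, so it begins where both have ended. If there is
no such position, only the top remains. -/
theorem isLUB_rightPoint {x y : Tower T} (hxy : ¬ x ≤ y) (hyx : ¬ y ≤ x) :
    IsLUB {x, y} (rightPoint x y) := by
  classical
  rcases x with _ | v
  · exact (hyx trivial).elim
  rcases y with _ | w
  · exact (hxy trivial).elim
  have key : ∀ a, @LE.le (Tower T) _ (some v) (some a) → @LE.le (Tower T) _ (some w) (some a) →
      v.1 ≤ a.1 ∧ w.1 ≤ a.1 ∧ EndsBy T v (left a) ∧ EndsBy T w (left a) := by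
    intro a hv hw
    rcases hv with rfl | hv
    · exact (hyx hw).elim
    rcases hw with rfl | hw
    · exact (hxy (Or.inr hv)).elim
    exact ⟨hv.1, hw.1, hv.2, hw.2⟩
  by_cases h : ∃ j, EndsBy T v j ∧ EndsBy T w j
  · have hr : rightPoint (T := T) (some v) (some w) = elem T (v.1 || w.1) false (Nat.find h) :=
      dif_pos h
    have hl : left (v.1 || w.1, false, Nat.find h) = Nat.find h := by simp [left]
    rw [hr]
    constructor
    · rintro _ (rfl | rfl)
      · exact Or.inr ⟨Bool.left_le_or _ _, hl.symm ▸ (Nat.find_spec h).1⟩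
      · exact Or.inr ⟨Bool.right_le_or _ _, hl.symm ▸ (Nat.find_spec h).2⟩
    · intro z hz
      rcases z with _ | a
      · trivial
      obtain ⟨h1, h2, h3, h4⟩ := key a (hz (Or.inl rfl)) (hz (Or.inr rfl))
      exact Or.inr ⟨Bool.or_le h1 h2, endsBy_point.2 (Nat.find_min' h ⟨h3, h4⟩)⟩
  · have hr : rightPoint (T := T) (some v) (some w) = ⊤ := dif_neg h
    rw [hr]
    refine ⟨fun _ _ => le_top, fun z hz => ?_⟩
    rcases z with _ | a
    · trivial
    obtain ⟨h1, h2, h3, h4⟩ := key a (hz (Or.inl rfl)) (hz (Or.inr rfl))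
    exact (h ⟨_, h3, h4⟩).elim

open scoped Classical in
/-- The meet of two elements. -/
noncomputable def meet (x y : Tower T) : Tower T :=
  if x ≤ y then x else if y ≤ x then y else leftPoint x y

open scoped Classical in
/-- The join of two elements. -/
noncomputable def join (x y : Tower T) : Tower T :=
  if x ≤ y then y else if y ≤ x then x else rightPoint x y

theorem isGLB_meet (x y : Tower T) : IsGLB {x, y} (meet x y) := by
  rw [meet]
  split_ifs with h1 h2
  · exact ⟨by simp [lowerBounds, h1], fun z hz => hz (Or.inl rfl)⟩
  · exact ⟨by simp [lowerBounds, h2], fun z hz => hz (Or.inr rfl)⟩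
  · exact isGLB_leftPoint h1 h2

theorem isLUB_join (x y : Tower T) : IsLUB {x, y} (join x y) := by
  rw [join]
  split_ifs with h1 h2
  · exact ⟨by simp [upperBounds, h1], fun z hz => hz (Or.inr rfl)⟩
  · exact ⟨by simp [upperBounds, h2], fun z hz => hz (Or.inl rfl)⟩
  · exact isLUB_rightPoint h1 h2

noncomputable instance : Lattice (Tower T) where
  sup := join
  inf := meet
  le_sup_left x y := (isLUB_join x y).1 (Or.inl rfl)
  le_sup_right x y := (isLUB_join x y).1 (Or.inr rfl)
  sup_le x y z h1 h2 := (isLUB_join x y).2 (by simp [upperBounds, h1, h2])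
  inf_le_left x y := (isGLB_meet x y).1 (Or.inl rfl)
  inf_le_right x y := (isGLB_meet x y).1 (Or.inr rfl)
  le_inf x y z h1 h2 := (isGLB_meet y z).2 (by simp [lowerBounds, h1, h2])

instance : BoundedOrder (Tower T) where

theorem elem_le_elem' {b g b' g' : Bool} {k k' : ℕ} :
    elem T b g k ≤ elem T b' g' k' ↔
      (b = b' ∧ g = g' ∧ k = k') ∨ (b ≤ b' ∧ EndsBy T (b, g, k) (left (b', g', k'))) :=
  (elem_le_elem (v := (b, g, k)) (w := (b', g', k'))).trans (by simp)

theorem not_top_le_elem {b g : Bool} {k : ℕ} : ¬ ⊤ ≤ elem T b g k := fun h => h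

/-- The interval that is never closed is a complement of everything but the extreme elements. -/
theorem isCompl_zero_interval {x : Tower T} (h0 : x ≠ ⊥) (h1 : x ≠ ⊤)
    (hz : x ≠ elem T false true 0) : IsCompl x (elem T false true 0) := by
  have below : ∀ y, y ≤ elem T false true 0 → y = ⊥ ∨ y = elem T false true 0 := by
    intro y hy
    rcases eq_top_or_elem y with rfl | ⟨b, g, k, rfl⟩
    · exact (not_top_le_elem hy).elim
    rcases elem_le_elem'.1 hy with ⟨rfl, rfl, rfl⟩ | ⟨hb, he⟩
    · exact Or.inr rfl
    · have hb : b = false := le_bot_iff.1 hb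
      subst hb
      cases g
      · have : k = 0 := by simpa [endsBy_point, left] using he
        subst this
        exact Or.inl rfl
      · exact ((T.lt (endsBy_interval.1 he)).not_ge (by simp [left])).elim
  have above : ∀ y, elem T false true 0 ≤ y → y = ⊤ ∨ y = elem T false true 0 := by
    intro y hy
    rcases eq_top_or_elem y with rfl | ⟨b, g, k, rfl⟩
    · exact Or.inl rfl
    rcases elem_le_elem'.1 hy with ⟨rfl, rfl, rfl⟩ | ⟨-, he⟩
    · exact Or.inr rfl
    · exact (T.zero _ (endsBy_interval.1 he)).elim
  constructor
  · rw [disjoint_iff]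
    refine (below _ inf_le_right).resolve_right fun h => ?_
    rcases above x (inf_eq_right.1 h) with h | h
    exacts [h1 h, hz h]
  · rw [codisjoint_iff]
    refine (above _ le_sup_right).resolve_right fun h => ?_
    rcases below x (sup_eq_right.1 h) with h | h
    exacts [h0 h, hz h]

theorem isComplementedLattice (T : Schedule) : IsComplementedLattice (Tower T) := by
  refine ⟨inferInstance, ⟨fun x => ?_⟩⟩
  by_cases h0 : x = ⊥
  · exact ⟨⊤, h0 ▸ isCompl_bot_top⟩
  by_cases h1 : x = ⊤
  · exact ⟨⊥, h1 ▸ isCompl_top_bot⟩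
  by_cases hz : x = elem T false true 0
  · refine ⟨elem T true false 0, hz ▸ (isCompl_zero_interval ?_ ?_ ?_).symm⟩
    · exact fun h => by simpa using (elem_injective.1 h).1
    · exact fun h => not_top_le_elem h.ge
    · exact fun h => by simpa using (elem_injective.1 h).1
  · exact ⟨_, isCompl_zero_interval h0 h1 hz⟩

/-- Two comparable points of the upper side share the interval `0` as a complement, which
distributivity forbids. -/
theorem isNonDistributive (T : Schedule) : IsNonDistributive (Tower T) := by
  intro h
  have hne : ∀ (b : Bool) (k : ℕ), b = true ∨ k ≠ 0 → IsCompl (elem T b false k)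
      (elem T false true 0) := fun b k hb => by
    refine isCompl_zero_interval (fun h => ?_) (fun h => not_top_le_elem h.ge) (fun h => ?_)
    · have := elem_injective.1 h
      rcases hb with hb | hb
      · simp [hb] at this
      · exact hb this.2.2
    · simpa using (elem_injective.1 h).2.1
  have h1 := h (elem T true false 1) (elem T false true 0) (elem T true false 0)
  rw [(hne true 0 (Or.inl rfl)).symm.sup_eq_top, (hne true 1 (Or.inl rfl)).inf_eq_bot,
    inf_top_eq, bot_sup_eq] at h1
  have h2 := inf_eq_left.1 h1.symm
  simp [elem_le_elem', endsBy_point, left] at h2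

/-! #### Computability -/

theorem computable_left : Computable left :=
  Computable.cond (Primrec.and.to_comp.comp (Computable.fst.comp Computable.snd)
      (Primrec.not.to_comp.comp Computable.fst))
    (Primrec.nat_double.to_comp.comp (Computable.snd.comp Computable.snd))
    (Computable.snd.comp Computable.snd)

theorem computablePred_endsBy (hT : ComputablePred fun p : ℕ × ℕ => T.closed p.1 p.2) :
    ComputablePred fun p : (Bool × Bool × ℕ) × ℕ => EndsBy T p.1 p.2 := by
  have hb : Computable fun p : (Bool × Bool × ℕ) × ℕ => p.1.1 := Computable.fst.comp Computable.fst
  have hg : Computable fun p : (Bool × Bool × ℕ) × ℕ => p.1.2.1 :=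
    Computable.fst.comp (Computable.snd.comp Computable.fst)
  have hk : Computable fun p : (Bool × Bool × ℕ) × ℕ => p.1.2.2 :=
    Computable.snd.comp (Computable.snd.comp Computable.fst)
  refine ((ComputablePred.eq hg (.const _)).and (.nat_le hk .snd)).or
    (((ComputablePred.eq hg (.const _)).and ((ComputablePred.eq hb (.const _)).and
      (.nat_le (Primrec.nat_add.to_comp.comp hk (.const 2)) .snd))).or
    ((ComputablePred.eq hg (.const _)).and ((ComputablePred.eq hb (.const _)).and
      (hT.comp (f := fun p : (Bool × Bool × ℕ) × ℕ => (p.1.2.2, p.2 / 2))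
        (hk.pair (Primrec.nat_div.to_comp.comp .snd (.const 2)))))))

theorem computablePred_le (hT : ComputablePred fun p : ℕ × ℕ => T.closed p.1 p.2) :
    ComputablePred fun p : Tower T × Tower T => p.1 ≤ p.2 := by
  classical
  have h : ComputablePred fun p : (Bool × Bool × ℕ) × (Bool × Bool × ℕ) =>
      p.1 = p.2 ∨ (p.1.1 ≤ p.2.1 ∧ EndsBy T p.1 (left p.2)) :=
    (ComputablePred.eq .fst .snd).or
      ((Computable.computablePred ((Primrec.dom_bool₂ fun a b => decide (a ≤ b)).to_comp.comp
        (Computable.fst.comp .fst) (Computable.fst.comp .snd))).and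
      ((computablePred_endsBy hT).comp (Computable.pair .fst (computable_left.comp .snd))))
  have hc : Computable fun p : Option (Bool × Bool × ℕ) × Option (Bool × Bool × ℕ) =>
      (Option.casesOn (motive := fun _ => Bool) p.2 true fun w =>
        Option.casesOn (motive := fun _ => Bool) p.1 false fun v =>
          decide (v = w ∨ (v.1 ≤ w.1 ∧ EndsBy T v (left w))) : Bool) :=
    Computable.option_casesOn .snd (.const true) (Computable.option_casesOn
      (Computable.fst.comp .fst) (.const false)
      (h.decide.comp (Computable.pair .snd (Computable.snd.comp .fst))).to₂).to₂
  refine (ComputablePred.computable_iff.2 ⟨_, hc, rfl⟩ : ComputablePred fun p :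
    Option (Bool × Bool × ℕ) × Option (Bool × Bool × ℕ) => _).of_eq fun p => ?_
  rcases p with ⟨_ | v, _ | w⟩
  · exact ⟨fun _ => trivial, fun _ => rfl⟩
  · exact ⟨fun h => Bool.noConfusion h, fun h => h.elim⟩
  · exact ⟨fun _ => trivial, fun _ => rfl⟩
  · exact decide_eq_true_iff

theorem computable_leftPoint : Computable₂ (leftPoint (T := T)) := by
  have h : Computable fun p : (Bool × Bool × ℕ) × (Bool × Bool × ℕ) =>
      ((p.1.1 && p.2.1, false, min (left p.1) (left p.2)) : Bool × Bool × ℕ) :=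
    (Primrec.and.to_comp.comp (Computable.fst.comp .fst) (Computable.fst.comp .snd)).pair
      ((Computable.const false).pair (Primrec.nat_min.to_comp.comp
        (computable_left.comp .fst) (computable_left.comp .snd)))
  have : Computable fun p : Option (Bool × Bool × ℕ) × Option (Bool × Bool × ℕ) =>
      Option.bind p.1 fun v =>
        Option.map (fun w : Bool × Bool × ℕ =>
          (v.1 && w.1, false, min (left v) (left w))) p.2 :=
    Computable.option_bind .fst (Computable.option_map (Computable.snd.comp .fst)
      (h.comp (Computable.pair (Computable.snd.comp .fst) .snd)).to₂).to₂
  exact this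

/-- Left ends are read off from the parameters, so the order test is the only use of the schedule.
-/
theorem computable_inf (hT : ComputablePred fun p : ℕ × ℕ => T.closed p.1 p.2) :
    Computable₂ fun x y : Tower T => x ⊓ y := by
  classical
  exact Computable.ite (computablePred_le hT) .fst (Computable.ite
    ((computablePred_le hT).comp (Computable.pair .snd .fst)) .snd computable_leftPoint)

end Tower
end Punctual

/-! ### Recognising an interval of a tower from finitely many elements -/

namespace Punctual

open Nat.Partrec (Code)

/-- A finite configuration in an order that identifies `y` as the `(m+1)`-st interval of a tower,
in terms of the least point `u` and the least interval `w` of the upper side. -/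
structure Detects {α : Type*} (r : α → α → Prop) (u w : α) (m : ℕ) (s : ℕ → α) (x x' y : α) :
    Prop where
  start : s 0 = w
  above : ∀ k < 2 * m + 5, r u (s k)
  incomp : ∀ k < 2 * m + 4, ¬ r (s k) (s (k + 1)) ∧ ¬ r (s (k + 1)) (s k)
  ne : ∀ k < 2 * m + 3, s k ≠ s (k + 2)
  lower : ¬ r u x ∧ r x (s (2 * m + 1)) ∧ ¬ r x (s (2 * m))
  upper : ¬ r u x' ∧ r x' (s (2 * m + 3)) ∧ ¬ r x' (s (2 * m + 2))
  between : ¬ r u y ∧ r x y ∧ ¬ r x' y ∧ ¬ r y (s (2 * m + 2))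

theorem Detects.map {α β : Type*} {r : α → α → Prop} {q : β → β → Prop} {u w : α} {m : ℕ}
    {s : ℕ → α} {x x' y : α} (h : Detects r u w m s x x' y) (f : α ≃ β)
    (hf : ∀ a b, r a b ↔ q (f a) (f b)) : Detects q (f u) (f w) m (fun k => f (s k)) (f x) (f x')
      (f y) := by
  obtain ⟨h1, h2, h3, h4, h5, h6, h7⟩ := h
  simp only [hf] at h2 h3 h5 h6 h7
  exact ⟨congrArg f h1, h2, h3, fun k hk h => h4 k hk (f.injective h), h5, h6, h7⟩

/-- Only finitely many terms of the path matter, so it can be coded by a list. -/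
theorem Detects.congr {α : Type*} {r : α → α → Prop} {u w : α} {m : ℕ}
    {s s' : ℕ → α} {x x' y : α} (h : Detects r u w m s x x' y) (hs : ∀ k < 2 * m + 5, s k = s' k) :
    Detects r u w m s' x x' y := by
  obtain ⟨h1, h2, h3, h4, h5, h6, h7⟩ := h
  rw [hs _ (by omega)] at h1
  rw [hs _ (by omega), hs _ (by omega)] at h5 h6
  rw [hs _ (by omega)] at h7
  exact ⟨h1, fun k hk => hs k hk ▸ h2 k hk,
    fun k hk => hs k (by omega) ▸ hs (k + 1) (by omega) ▸ h3 k hk,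
    fun k hk => hs k (by omega) ▸ hs (k + 2) (by omega) ▸ h4 k hk, h5, h6, h7⟩

namespace Tower

variable {T : Schedule}

theorem not_upper {y : Tower T} (h : ¬ elem T true false 0 ≤ y) :
    ∃ g k, y = elem T false g k := by
  rcases eq_top_or_elem y with rfl | ⟨b, g, k, rfl⟩
  · exact (h le_top).elim
  cases b
  · exact ⟨g, k, rfl⟩
  · exact (h (Or.inr ⟨le_rfl, endsBy_point.2 (Nat.zero_le _)⟩)).elim

theorem upper {y : Tower T} (h : elem T true false 0 ≤ y) :
    y = ⊤ ∨ ∃ g k, y = elem T true g k := by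
  rcases eq_top_or_elem y with rfl | ⟨b, g, k, rfl⟩
  · exact Or.inl rfl
  cases b
  · rcases elem_le_elem'.1 h with h | h
    · exact absurd h.1 (by simp)
    · exact absurd h.1 (by simp)
  · exact Or.inr ⟨g, k, rfl⟩

theorem wide_le_wide {k l : ℕ} : elem T true true k ≤ elem T true true l ↔ k = l ∨ k + 2 ≤ l := by
  simp [elem_le_elem', endsBy_wide, left]

theorem wide_le_point {k l : ℕ} : elem T true true k ≤ elem T true false l ↔ k + 2 ≤ l := by
  simp [elem_le_elem', endsBy_wide, left]

theorem point_le_wide {b : Bool} {k l : ℕ} : elem T b false k ≤ elem T true true l ↔ k ≤ l := by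
  simp [elem_le_elem', endsBy_point, left]

theorem point_le_point {b : Bool} {k l : ℕ} :
    elem T b false k ≤ elem T b false l ↔ k ≤ l := by
  simp [elem_le_elem', endsBy_point, left]
  omega

theorem point_le_interval {k l : ℕ} : elem T false false k ≤ elem T false true l ↔ k ≤ 2 * l := by
  simp [elem_le_elem', endsBy_point, left]

theorem interval_le_wide {k l : ℕ} :
    elem T false true k ≤ elem T true true l ↔ T.closed k (l / 2) := by
  simp [elem_le_elem', endsBy_interval, left]

/-- Wide intervals overlap only when their indices differ by one, and `k + 1` is the only point
strictly inside `[k, k + 2]`. -/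
theorem incomparable_wide {k : ℕ} {y : Tower T} (hu : elem T true false 0 ≤ y)
    (h1 : ¬ elem T true true k ≤ y) (h2 : ¬ y ≤ elem T true true k) :
    y = elem T true true (k + 1) ∨ y = elem T true false (k + 1) ∨
      (0 < k ∧ y = elem T true true (k - 1)) := by
  rcases upper hu with rfl | ⟨g, l, rfl⟩
  · exact (h1 le_top).elim
  cases g
  · rw [wide_le_point] at h1
    rw [point_le_wide] at h2
    obtain rfl : l = k + 1 := by omega
    exact Or.inr (Or.inl rfl)
  · rw [wide_le_wide] at h1 h2
    rcases (by omega : l = k + 1 ∨ l = k - 1 ∧ 0 < k) with rfl | ⟨rfl, h⟩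
    exacts [Or.inl rfl, Or.inr (Or.inr ⟨h, rfl⟩)]

theorem incomparable_point {k : ℕ} {y : Tower T} (hu : elem T true false 0 ≤ y)
    (h1 : ¬ elem T true false (k + 1) ≤ y) (h2 : ¬ y ≤ elem T true false (k + 1)) :
    y = elem T true true k := by
  rcases upper hu with rfl | ⟨g, l, rfl⟩
  · exact (h1 le_top).elim
  cases g
  · rw [point_le_point] at h1 h2
    omega
  · rw [point_le_wide] at h1
    rw [wide_le_point] at h2
    obtain rfl : l = k := by omega
    rfl

/-- From a wide interval the path can advance, step back, or enter the point inside. Stepping back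
is excluded by `ne`. The point is incomparable only to the interval just left, so the next term
would again violate `ne`. This is why the path extends one term beyond the last one determined. -/
theorem path_eq {s : ℕ → Tower T} {n : ℕ} (start : s 0 = elem T true true 0)
    (above : ∀ k < n + 2, elem T true false 0 ≤ s k)
    (incomp : ∀ k < n + 1, ¬ s k ≤ s (k + 1) ∧ ¬ s (k + 1) ≤ s k)
    (ne : ∀ k < n, s k ≠ s (k + 2)) : ∀ k ≤ n, s k = elem T true true k := by
  intro k
  induction k using Nat.strong_induction_on with
  | _ k ih =>
    intro hk
    rcases k with _ | k
    · exact start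
    have hk1 := ih k (by omega) (by omega)
    have hi := incomp k (by omega)
    rw [hk1] at hi
    rcases incomparable_wide (above (k + 1) (by omega)) hi.1 hi.2 with h | h | ⟨h0, h⟩
    · exact h
    · have hi' := incomp (k + 1) (by omega)
      rw [h] at hi'
      have := incomparable_point (above (k + 2) (by omega)) hi'.1 hi'.2
      exact (ne k (by omega) (hk1.trans this.symm)).elim
    · obtain ⟨j, rfl⟩ : ∃ j, k = j + 1 := ⟨k - 1, by omega⟩
      exact (ne j (by omega) ((ih j (by omega) (by omega)).trans h.symm)).elim

/-- Lower intervals end only at even positions, so none can end exactly at `2 * m + 1`. -/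
theorem eq_odd_point {x : Tower T} {m : ℕ} (h : ¬ elem T true false 0 ≤ x)
    (h1 : x ≤ elem T true true (2 * m + 1)) (h2 : ¬ x ≤ elem T true true (2 * m)) :
    x = elem T false false (2 * m + 1) := by
  obtain ⟨g, k, rfl⟩ := not_upper h
  cases g
  · rw [point_le_wide] at h1 h2
    obtain rfl : k = 2 * m + 1 := by omega
    rfl
  · rw [interval_le_wide] at h1 h2
    rw [show (2 * m + 1) / 2 = 2 * m / 2 by omega] at h1
    exact (h2 h1).elim

/-- The path acts as a ruler that fixes `x` and `x'` as the points `2 * m + 1` and `2 * m + 3`. The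
element `y` begins between them and is not a point, since such a point would be below the wide
interval `2 * m + 2`. Lower intervals begin at even positions, which leaves only `2 * m + 2`.
Nothing here depends on whether the interval is ever closed. -/
theorem eq_of_detects {m : ℕ} {s : ℕ → Tower T} {x x' y : Tower T}
    (h : Detects (· ≤ ·) (elem T true false 0) (elem T true true 0) m s x x' y) :
    y = elem T false true (m + 1) := by
  have hs := path_eq (n := 2 * m + 3) h.start h.above h.incomp h.ne
  obtain ⟨l0, l1, l2⟩ := h.lower
  rw [hs _ (by omega)] at l1 l2
  have hx := eq_odd_point l0 l1 l2
  obtain ⟨u0, u1, u2⟩ := h.upper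
  rw [hs _ (by omega)] at u1 u2
  have hx' := eq_odd_point (m := m + 1) u0 u1 u2
  obtain ⟨b0, b1, b2, b3⟩ := h.between
  rw [hs _ (by omega)] at b3
  rw [hx] at b1
  rw [hx'] at b2
  obtain ⟨g, k, rfl⟩ := not_upper b0
  cases g
  · rw [point_le_point] at b1 b2
    rw [point_le_wide] at b3
    omega
  · rw [point_le_interval] at b1 b2
    obtain rfl : k = m + 1 := by omega
    rfl

theorem detects {m : ℕ} (h : ∀ k, ¬ T.closed (m + 1) k) :
    Detects (· ≤ ·) (elem T true false 0) (elem T true true 0) m (elem T true true)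
      (elem T false false (2 * m + 1)) (elem T false false (2 * m + 3))
      (elem T false true (m + 1)) where
  start := rfl
  above k _ := point_le_wide.2 (Nat.zero_le k)
  incomp k _ := by
    rw [wide_le_wide, wide_le_wide]
    omega
  ne k _ h := by
    have := (elem_injective.1 h).2.2
    omega
  lower := by
    refine ⟨?_, ?_, ?_⟩
    · simp [elem_le_elem']
    · rw [point_le_wide]
    · rw [point_le_wide]; omega
  upper := by
    refine ⟨?_, ?_, ?_⟩
    · simp [elem_le_elem']
    · rw [point_le_wide]
    · rw [point_le_wide]; omega
  between := by
    refine ⟨?_, ?_, ?_, ?_⟩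
    · simp [elem_le_elem']
    · rw [point_le_interval]; omega
    · rw [point_le_interval]; omega
    · rw [interval_le_wide]; exact h _

theorem eq_top_of_interval_le {n : ℕ} (h : ∀ k, ¬ T.closed n k) {y : Tower T}
    (hy : elem T false true n ≤ y) : y = elem T false true n ∨ y = ⊤ := by
  rcases eq_top_or_elem y with rfl | ⟨b, g, k, rfl⟩
  · exact Or.inr rfl
  rcases elem_le_elem'.1 hy with ⟨rfl, rfl, rfl⟩ | ⟨-, he⟩
  · exact Or.inl rfl
  · exact (h _ (endsBy_interval.1 he)).elim

/-- Few elements are not above a closed interval. -/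
theorem card_not_above {n k : ℕ} (h : T.closed n k) (S : Finset (Tower T))
    (hS : ∀ y ∈ S, ¬ elem T false true n ≤ y) : S.card ≤ 8 * k := by
  classical
  -- An element of index at least `2 * k` begins where the closed interval has already ended. There
  -- are four kinds of elements, each with `2 * k` smaller indices.
  let F : Finset (Tower T) := (Finset.univ ×ˢ Finset.univ ×ˢ Finset.range (2 * k)).image
    fun v : Bool × Bool × ℕ => elem T v.1 v.2.1 v.2.2
  have hF : F.card ≤ 8 * k := by
    refine Finset.card_image_le.trans ?_
    simp only [Finset.card_product, Finset.card_univ, Fintype.card_bool, Finset.card_range]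
    omega
  refine (Finset.card_le_card fun y hy => ?_).trans hF
  have hy' := hS y hy
  rcases eq_top_or_elem y with rfl | ⟨b, g, l, rfl⟩
  · exact (hy' le_top).elim
  refine Finset.mem_image.2 ⟨(b, g, l), ?_, rfl⟩
  simp only [Finset.mem_product, Finset.mem_univ, Finset.mem_range, true_and]
  by_contra hl
  refine hy' (Or.inr ⟨Bool.false_le _, EndsBy.mono (i := 2 * k) ?_ ?_⟩)
  · exact endsBy_interval.2 (by simpa using h)
  · have : l ≤ left (b, g, l) := by
      simp only [left]
      cases b <;> cases g <;> simp
      omega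
    omega

end Tower

/-! ### The diagonal tower -/

/-- The binary relation on the natural numbers with the given code. -/
def codeRel (e : Code) (a b : ℕ) : Prop := primEval₂ e a b = 1

theorem computablePred_codeRel {α : Type} [Primcodable α] {e : α → Code} {f g : α → ℕ}
    (he : Computable e) (hf : Computable f) (hg : Computable g) :
    ComputablePred fun a => codeRel (e a) (f a) (g a) :=
  ComputablePred.eq (computable_primEval₂.comp (he.pair (hf.pair hg))) (.const 1)

theorem exists_codeRel_iff {r : ℕ → ℕ → Prop} (hr : PrimrecRel r) :
    ∃ e, ∀ a b, codeRel e a b ↔ r a b := by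
  classical
  obtain ⟨e, he⟩ := exists_primEval₂_eq
    (f := fun a b => if r a b then 1 else 0) (Primrec.ite hr (.const 1) (.const 0))
  exact ⟨e, fun a b => by simp [codeRel, he]⟩

/-- The configuration `c` identifies an interval that is maximal, up to `t`, on a large set. -/
def Acts (q : Code × ℕ × ℕ × ℕ) (m c : ℕ) (d : List ℕ × ℕ × ℕ × ℕ) : Prop :=
  Detects (codeRel q.1) q.2.1 q.2.2.1 m (fun k => d.1.getD k 0) d.2.1 d.2.2.1 d.2.2.2 ∧
    ∀ b < 8 * (c + m) + 19, codeRel q.1 d.2.2.2 b → b = d.2.2.2 ∨ b = q.2.2.2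

/-- The `m`-th tuple of an index of an order and three parameters. -/
def requirement (m : ℕ) : Code × ℕ × ℕ × ℕ :=
  (Encodable.decode m).getD (Code.zero, 0, 0, 0)

/-- The finite configuration with code `c`. -/
def configuration (c : ℕ) : List ℕ × ℕ × ℕ × ℕ :=
  (Encodable.decode c).getD ([], 0, 0, 0)

/-- The configuration with code `c` closes the `n`-th interval. -/
def ActsAt (n c : ℕ) : Prop := Acts (requirement (n - 1)) (n - 1) c (configuration c)

/-- The schedule of the diagonal tower. -/
def diagonalSchedule : Schedule where
  closed n k := (0 < n ∧ n < k) ∧ ∃ c < k, ActsAt n c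
  mono h hkl := ⟨⟨h.1.1, h.1.2.trans_le hkl⟩, h.2.imp fun _ hc => ⟨hc.1.trans_le hkl, hc.2⟩⟩
  lt h := h.1.2
  zero _ h := h.1.1.false

theorem computablePred_detects {α : Type} [Primcodable α] {e : α → Code} {u w m : α → ℕ}
    {s : α → ℕ → ℕ} {x x' y : α → ℕ} (he : Computable e) (hu : Computable u) (hw : Computable w)
    (hm : Computable m) (hs : Computable₂ s) (hx : Computable x) (hx' : Computable x')
    (hy : Computable y) :
    ComputablePred fun a => Detects (codeRel (e a)) (u a) (w a) (m a) (s a) (x a) (x' a) (y a) := by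
  have lin : ∀ i : ℕ, Computable fun a => 2 * m a + i := fun i =>
    Primrec.nat_add.to_comp.comp (Primrec.nat_double.to_comp.comp hm) (.const i)
  have step : ∀ i : ℕ, Computable fun p : α × ℕ => s p.1 (p.2 + i) := fun i =>
    hs.comp .fst (Primrec.nat_add.to_comp.comp .snd (.const i))
  have fixed : ∀ i : ℕ, Computable fun a => s a (2 * m a + i) := fun i => hs.comp .id (lin i)
  have hef : Computable fun p : α × ℕ => e p.1 := he.comp .fst
  have huf : Computable fun p : α × ℕ => u p.1 := hu.comp .fst
  have h1 : ComputablePred fun a => s a 0 = w a := .eq (hs.comp .id (.const 0)) hw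
  have h2 : ComputablePred fun a => ∀ k < 2 * m a + 5, codeRel (e a) (u a) (s a k) :=
    ComputablePred.forall_lt (p := fun a k => codeRel (e a) (u a) (s a k))
      (computablePred_codeRel hef huf (step 0)) (lin 5)
  have h3 : ComputablePred fun a => ∀ k < 2 * m a + 4, ¬ codeRel (e a) (s a k) (s a (k + 1)) ∧
      ¬ codeRel (e a) (s a (k + 1)) (s a k) :=
    ComputablePred.forall_lt (p := fun a k => ¬ codeRel (e a) (s a k) (s a (k + 1)) ∧
      ¬ codeRel (e a) (s a (k + 1)) (s a k))
      ((computablePred_codeRel hef (step 0) (step 1)).not.and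
        (computablePred_codeRel hef (step 1) (step 0)).not) (lin 4)
  have h4 : ComputablePred fun a => ∀ k < 2 * m a + 3, s a k ≠ s a (k + 2) :=
    ComputablePred.forall_lt (p := fun a k => s a k ≠ s a (k + 2))
      (ComputablePred.eq (step 0) (step 2)).not (lin 3)
  have h5 := (computablePred_codeRel he hu hx).not.and ((computablePred_codeRel he hx (fixed 1)).and (computablePred_codeRel he hx (fixed 0)).not)
  have h6 := (computablePred_codeRel he hu hx').not.and ((computablePred_codeRel he hx' (fixed 3)).and (computablePred_codeRel he hx' (fixed 2)).not)
  have h7 := (computablePred_codeRel he hu hy).not.and ((computablePred_codeRel he hx hy).and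
    ((computablePred_codeRel he hx' hy).not.and (computablePred_codeRel he hy (fixed 2)).not))
  exact (h1.and (h2.and (h3.and (h4.and (h5.and (h6.and h7)))))).of_eq fun a =>
    ⟨fun ⟨h1, h2, h3, h4, h5, h6, h7⟩ => ⟨h1, h2, h3, h4, h5, h6, h7⟩,
      fun ⟨h1, h2, h3, h4, h5, h6, h7⟩ => ⟨h1, h2, h3, h4, h5, h6, h7⟩⟩

theorem computablePred_acts {α : Type} [Primcodable α] {q : α → Code × ℕ × ℕ × ℕ} {m c : α → ℕ}
    {d : α → List ℕ × ℕ × ℕ × ℕ} (hq : Computable q) (hm : Computable m) (hc : Computable c)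
    (hd : Computable d) : ComputablePred fun a => Acts (q a) (m a) (c a) (d a) := by
  have he := Computable.fst.comp hq
  have hy := Computable.snd.comp (Computable.snd.comp (Computable.snd.comp hd))
  have hs : Computable₂ fun a k => (d a).1.getD k 0 :=
    (Primrec.list_getD 0).to_comp.comp (Computable.fst.comp (hd.comp .fst)) .snd
  refine (computablePred_detects he (Computable.fst.comp (Computable.snd.comp hq))
    (Computable.fst.comp (Computable.snd.comp (Computable.snd.comp hq))) hm hs
    (Computable.fst.comp (Computable.snd.comp hd))
    (Computable.fst.comp (Computable.snd.comp (Computable.snd.comp hd))) hy).and ?_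
  refine ComputablePred.forall_lt (ComputablePred.imp ?_ (ComputablePred.or ?_ ?_)) ?_
  · exact computablePred_codeRel (he.comp .fst) (hy.comp .fst) .snd
  · exact ComputablePred.eq .snd (hy.comp .fst)
  · exact ComputablePred.eq .snd
      ((Computable.snd.comp (Computable.snd.comp (Computable.snd.comp hq))).comp .fst)
  · exact Primrec.nat_add.to_comp.comp (Primrec.nat_mul.to_comp.comp (.const 8)
      (Primrec.nat_add.to_comp.comp hc hm)) (.const 19)

theorem computable_requirement : Computable requirement :=
  Computable.option_getD Computable.decode (.const _)

theorem computable_configuration : Computable configuration :=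
  Computable.option_getD Computable.decode (.const _)

theorem computablePred_actsAt : ComputablePred fun p : ℕ × ℕ => ActsAt p.1 p.2 :=
  have hm : Computable fun p : ℕ × ℕ => p.1 - 1 := Primrec.pred.to_comp.comp .fst
  computablePred_acts (computable_requirement.comp hm) hm .snd (computable_configuration.comp .snd)

theorem computablePred_exists_actsAt :
    ComputablePred fun p : ℕ × ℕ => ∃ c < p.2, ActsAt p.1 c :=
  ComputablePred.exists_lt (p := fun (p : ℕ × ℕ) c => ActsAt p.1 c)
    (computablePred_actsAt.comp (f := fun p : (ℕ × ℕ) × ℕ => (p.1.1, p.2))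
      (Computable.pair (Computable.fst.comp .fst) .snd)) .snd

theorem _root_.ComputablePred.nat_lt {α : Type*} [Primcodable α] {f g : α → ℕ}
    (hf : Computable f) (hg : Computable g) : ComputablePred fun a => f a < g a :=
  ComputablePred.nat_le (Computable.succ.comp hf) hg

theorem computablePred_diagonalSchedule :
    ComputablePred fun p : ℕ × ℕ => diagonalSchedule.closed p.1 p.2 :=
  ((ComputablePred.nat_lt (.const 0) .fst).and (ComputablePred.nat_lt .fst .snd)).and
    computablePred_exists_actsAt

/-- The diagonal tower has no primitive recursive copy. -/
theorem not_primrecRel_diagonalTower {r : ℕ → ℕ → Prop} (hr : PrimrecRel r)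
    (f : Tower diagonalSchedule ≃ ℕ) (hf : ∀ x y, x ≤ y ↔ r (f x) (f y)) : False := by
  obtain ⟨e, he⟩ := exists_codeRel_iff hr
  have hfe : ∀ x y, x ≤ y ↔ codeRel e (f x) (f y) := fun x y => (hf x y).trans (he _ _).symm
  let q : Code × ℕ × ℕ × ℕ := (e, f (Tower.elem _ true false 0), f (Tower.elem _ true true 0), f ⊤)
  obtain ⟨m, hm⟩ : ∃ m, requirement m = q := ⟨Encodable.encode q, by
    simp only [requirement, Encodable.encodek, Option.getD_some]⟩
  have hacts : ∀ c, ActsAt (m + 1) c ↔ Acts q m c (configuration c) := fun c => by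
    simp only [ActsAt, Nat.add_sub_cancel, hm]
  by_cases hc : ∃ c, ActsAt (m + 1) c
  · obtain ⟨c, hc⟩ := hc
    -- The stage `c + m + 2` exceeds both the configuration `c` and the index `m + 1`.
    have hclosed : diagonalSchedule.closed (m + 1) (c + m + 2) :=
      ⟨⟨by omega, by omega⟩, c, by omega, hc⟩
    obtain ⟨hd, htop⟩ := (hacts c).1 hc
    have hd' := hd.map (q := (· ≤ ·)) f.symm fun a b => by rw [hfe]; simp [q]
    simp only [q, Equiv.symm_apply_apply] at hd'
    have hy := Tower.eq_of_detects hd'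
    rw [Equiv.symm_apply_eq] at hy
    rw [hy] at htop
    -- At least `8 * (c + m) + 17` numbers below the bound differ from the two exceptions, hence are
    -- not above the interval. Closure by stage `c + m + 2` allows at most `8 * (c + m) + 16`.
    let S := ((Finset.range (8 * (c + m) + 19)) \ {f (Tower.elem _ false true (m + 1)), f ⊤}).map
      f.symm.toEmbedding
    have hcard := Tower.card_not_above hclosed S fun y hyS hle => by
      obtain ⟨b, hb, rfl⟩ := Finset.mem_map.1 hyS
      simp only [Finset.mem_sdiff, Finset.mem_range, Finset.mem_insert, Finset.mem_singleton] at hb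
      exact hb.2 (htop b hb.1 (by simpa [hfe] using hle))
    have h1 := Finset.le_card_sdiff {f (Tower.elem _ false true (m + 1)), f ⊤}
      (Finset.range (8 * (c + m) + 19))
    have h2 := Finset.card_le_two (a := f (Tower.elem _ false true (m + 1))) (b := f ⊤)
    rw [Finset.card_map] at hcard
    rw [Finset.card_range] at h1
    omega
  -- The interval is never closed, so the image of its true configuration acts after all.
  · have hopen : ∀ k, ¬ diagonalSchedule.closed (m + 1) k := fun k h =>
      hc (h.2.imp fun _ h => h.2)
    have hd := (Tower.detects hopen).map f hfe
    let d : List ℕ × ℕ × ℕ × ℕ :=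
      ((List.range (2 * m + 5)).map fun k => f (Tower.elem _ true true k),
        f (Tower.elem _ false false (2 * m + 1)), f (Tower.elem _ false false (2 * m + 3)),
        f (Tower.elem _ false true (m + 1)))
    refine hc ⟨Encodable.encode d, (hacts _).2 ?_⟩
    have hconf : configuration (Encodable.encode d) = d := by
      simp only [configuration, Encodable.encodek, Option.getD_some]
    rw [hconf]
    have hs : ∀ k < 2 * m + 5, d.1.getD k 0 = f (Tower.elem _ true true k) := fun k hk => by
      simp [d, List.getD, hk]
    refine ⟨?_, fun b _ hb => ?_⟩
    · exact hd.congr fun k hk => (hs k hk).symm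
    · obtain ⟨y, rfl⟩ := f.surjective b
      exact (Tower.eq_top_of_interval_le hopen ((hfe _ _).2 hb)).imp (congrArg f) (congrArg f)

end Punctual

namespace Punctual

open Nat.Partrec (Code)

/-! ### The comb lattices -/

/-- The term that moves up the chain of a comb. -/
def stepTerm {α : Type*} (sup inf : α → α → α) (p q r x : α) : α :=
  sup (sup (inf (sup x p) (sup x q)) (inf (sup x p) (sup x r))) (inf (sup x q) (sup x r))

/-- The comb with parameter `σ`. Its elements are a greatest element and pairs `(i, m)`; the pairs
`(0, m)` form a chain, to which the other lines `i` are attached. -/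
def Comb (_ : ℕ → Bool) : Type := Option (ℕ × ℕ)

namespace Comb

variable {σ : ℕ → Bool}

instance : Primcodable (Comb σ) := inferInstanceAs (Primcodable (Option (ℕ × ℕ)))

instance : Infinite (Comb σ) := inferInstanceAs (Infinite (Option (ℕ × ℕ)))

instance : DecidableEq (Comb σ) := inferInstanceAs (DecidableEq (Option (ℕ × ℕ)))

/-- The element of the comb on the line `i` with index `m`. -/
def elem (σ : ℕ → Bool) (i m : ℕ) : Comb σ := some (i, m)

/-- The number of the greatest chain element below the `m`-th element of the line `i`. -/
def level (σ : ℕ → Bool) (i m : ℕ) : ℕ :=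
  if i = 0 then m else if i ≤ 3 then 3 * m + (i - 1) else if i = 4 then 3 * m + (σ m).toNat else 0

theorem level_zero (m : ℕ) : level σ 0 m = m := rfl

theorem level_mono {i m n : ℕ} (h : m ≤ n) : level σ i m ≤ level σ i n := by
  have h1 := Bool.toNat_le (σ m)
  rcases h.eq_or_lt with rfl | h
  · rfl
  simp only [level]
  split_ifs <;> omega

/-- The least element of the line `j` above the chain element `n` and with index at least `m`. -/
def raise (σ : ℕ → Bool) (n j m : ℕ) : Option (ℕ × ℕ) :=
  if n ≤ level σ j m then some (j, m) else
    if n ≤ level σ j (n / 3) then some (j, n / 3) else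
      if n ≤ level σ j (n / 3 + 1) then some (j, n / 3 + 1) else none

/-- The join of two elements. -/
def join (x y : Option (ℕ × ℕ)) : Option (ℕ × ℕ) :=
  Option.bind x fun v => Option.bind y fun w =>
    if v.1 = w.1 then some (v.1, max v.2 w.2) else
      if v.1 = 0 then raise σ v.2 w.1 w.2 else
        if w.1 = 0 then raise σ w.2 v.1 v.2 else none

/-- The meet of two elements. -/
def meet (x y : Option (ℕ × ℕ)) : Option (ℕ × ℕ) :=
  Option.casesOn x y fun v => Option.casesOn y (some v) fun w =>
    if v.1 = w.1 then some (v.1, min v.2 w.2) else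
      some (0, min (level σ v.1 v.2) (level σ w.1 w.2))

/-- The order on the elements other than the greatest one. -/
def Below (σ : ℕ → Bool) (v w : ℕ × ℕ) : Prop :=
  (v.1 = w.1 ∧ v.2 ≤ w.2) ∨ (v.1 = 0 ∧ v.2 ≤ level σ w.1 w.2)

theorem Below.level_le {v w : ℕ × ℕ} (h : Below σ v w) : level σ v.1 v.2 ≤ level σ w.1 w.2 := by
  rcases h with ⟨h, h'⟩ | ⟨h, h'⟩
  · rw [h]; exact level_mono h'
  · rwa [h]

instance : PartialOrder (Comb σ) where
  le x y := Option.casesOn (motive := fun _ => Prop) y True fun w =>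
    Option.casesOn (motive := fun _ => Prop) x False fun v => Below σ v w
  le_refl x := by
    rcases x with _ | v
    · trivial
    · exact Or.inl ⟨rfl, le_rfl⟩
  le_trans x y z hxy hyz := by
    rcases z with _ | c
    · trivial
    rcases y with _ | b
    · exact hyz.elim
    rcases x with _ | a
    · exact hxy.elim
    have hyz' : Below σ b c := hyz
    rcases hxy with ⟨h1, h2⟩ | ⟨h1, h2⟩
    · rcases hyz with ⟨h3, h4⟩ | ⟨h3, h4⟩
      · exact Or.inl ⟨h1.trans h3, h2.trans h4⟩
      · exact Or.inr ⟨h1.trans h3, h2.trans h4⟩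
    · exact Or.inr ⟨h1, h2.trans hyz'.level_le⟩
  le_antisymm x y hxy hyx := by
    rcases x with _ | ⟨i, m⟩ <;> rcases y with _ | ⟨j, n⟩
    · rfl
    · exact hxy.elim
    · exact hyx.elim
    · have h : i = j ∧ m = n := by
        rcases hxy with ⟨h1, h2⟩ | ⟨h1, h2⟩ <;> rcases hyx with ⟨h3, h4⟩ | ⟨h3, h4⟩ <;>
          simp only at h1 h2 h3 h4
        · omega
        · subst h3 h1; rw [level_zero] at h4; omega
        · subst h1 h3; rw [level_zero] at h2; omega
        · subst h1 h3; rw [level_zero] at h2 h4; omega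
      rw [h.1, h.2]

instance : OrderTop (Comb σ) where
  top := none
  le_top _ := trivial

instance : OrderBot (Comb σ) where
  bot := elem σ 0 0
  bot_le x := by
    rcases x with _ | v
    · trivial
    · exact Or.inr ⟨rfl, Nat.zero_le _⟩

/-- On the lines `1` to `4` the index `l` has level between `3 * l` and `3 * l + 2`. So no index
below `n / 3` reaches level `n`, and `n / 3 + 1` always does. Further lines have constant level `0`,
where `m` works or nothing does. -/
theorem below_raise {n j m k : ℕ} (hj : j ≠ 0) (h : n ≤ level σ j k) (hm : m ≤ k) :
    ∃ l ≤ k, raise σ n j m = some (j, l) := by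
  rw [raise]
  split_ifs with h1 h2 h3
  · exact ⟨m, hm, rfl⟩
  · refine ⟨n / 3, ?_, rfl⟩
    have := Bool.toNat_le (σ k)
    simp only [level] at h h1 h2
    split_ifs at h h1 h2 <;> omega
  · refine ⟨n / 3 + 1, ?_, rfl⟩
    by_contra hk
    exact h2 (h.trans (level_mono (by omega)))
  · have := Bool.toNat_le (σ k)
    simp only [level] at h h1 h2 h3
    split_ifs at h h1 h2 h3 <;> omega

theorem raise_spec {n j m : ℕ} {w : ℕ × ℕ} (hj : j ≠ 0) (h : raise σ n j m = some w) :
    w.1 = j ∧ m ≤ w.2 ∧ n ≤ level σ j w.2 := by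
  rw [raise] at h
  -- Success at some `l` after failure at `m` excludes the lines of constant level, so `3 * m` is at
  -- most the level of `m`, which is below `n`.
  have key : ∀ l, ¬ n ≤ level σ j m → n ≤ level σ j l → m ≤ n / 3 := by
    intro l h1 h2
    simp only [level] at h1 h2
    split_ifs at h1 h2 <;> omega
  split_ifs at h with h1 h2 h3
  · cases h
    exact ⟨rfl, le_rfl, h1⟩
  · cases h
    exact ⟨rfl, key _ h1 h2, h2⟩
  · cases h
    exact ⟨rfl, (key _ h1 h3).trans (Nat.le_succ _), h3⟩

theorem isLUB_raise {n j m : ℕ} (hj : j ≠ 0) :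
    IsLUB {elem σ 0 n, elem σ j m} (raise σ n j m : Option (ℕ × ℕ)) := by
  constructor
  · rcases hr : raise σ n j m with _ | w
    · exact fun _ _ => le_top
    obtain ⟨rfl, h2, h3⟩ := raise_spec hj hr
    rintro _ (rfl | rfl)
    · exact Or.inr ⟨rfl, h3⟩
    · exact Or.inl ⟨rfl, h2⟩
  · intro z hz
    have h1 : elem σ 0 n ≤ z := hz (Or.inl rfl)
    have h2 : elem σ j m ≤ z := hz (Or.inr rfl)
    rcases z with _ | ⟨i, k⟩
    · trivial
    rcases h2 with ⟨h2, h3⟩ | ⟨h2, -⟩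
    · obtain rfl : j = i := h2
      have h4 : n ≤ level σ j k := by
        rcases h1 with ⟨h1, -⟩ | ⟨-, h1⟩
        · exact (hj h1.symm).elim
        · exact h1
      obtain ⟨l, hl, hr⟩ := below_raise hj h4 h3
      rw [hr]
      exact Or.inl ⟨rfl, hl⟩
    · exact (hj h2).elim

theorem isLUB_join (x y : Comb σ) : IsLUB {x, y} (join (σ := σ) x y : Option (ℕ × ℕ)) := by
  rcases x with _ | ⟨i, m⟩
  · exact ⟨fun _ _ => le_top, fun z hz => hz (Or.inl rfl)⟩
  rcases y with _ | ⟨j, n⟩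
  · exact ⟨fun _ _ => le_top, fun z hz => hz (Or.inr rfl)⟩
  simp only [join, Option.bind_some]
  split_ifs with h1 h2 h3
  · subst h1
    constructor
    · rintro _ (rfl | rfl)
      · exact Or.inl ⟨rfl, le_max_left _ _⟩
      · exact Or.inl ⟨rfl, le_max_right _ _⟩
    · intro z hz
      rcases max_choice m n with h | h <;> rw [h]
      exacts [hz (Or.inl rfl), hz (Or.inr rfl)]
  · subst h2
    exact isLUB_raise (Ne.symm h1)
  · subst h3
    have h := isLUB_raise (σ := σ) (n := n) (m := m) h1
    rwa [Set.pair_comm] at h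
  · refine ⟨fun _ _ => le_top, fun z hz => ?_⟩
    rcases z with _ | ⟨k, l⟩
    · trivial
    rcases hz (Or.inl rfl) with ⟨h4, -⟩ | ⟨h4, -⟩
    · rcases hz (Or.inr rfl) with ⟨h5, -⟩ | ⟨h5, -⟩
      · exact (h1 (h4.trans h5.symm)).elim
      · exact (h3 h5).elim
    · exact (h2 h4).elim

theorem isGLB_meet (x y : Comb σ) : IsGLB {x, y} (meet (σ := σ) x y : Option (ℕ × ℕ)) := by
  rcases x with _ | ⟨i, m⟩
  · refine ⟨?_, fun z hz => hz (Or.inr rfl)⟩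
    rintro _ (rfl | rfl)
    exacts [le_top, le_rfl]
  rcases y with _ | ⟨j, n⟩
  · refine ⟨?_, fun z hz => hz (Or.inl rfl)⟩
    rintro _ (rfl | rfl)
    exacts [le_rfl, le_top]
  simp only [meet]
  split_ifs with h1
  · subst h1
    constructor
    · rintro _ (rfl | rfl)
      · exact Or.inl ⟨rfl, min_le_left _ _⟩
      · exact Or.inl ⟨rfl, min_le_right _ _⟩
    · intro z hz
      rcases min_choice m n with h | h <;> rw [h]
      exacts [hz (Or.inl rfl), hz (Or.inr rfl)]
  · constructor
    · rintro _ (rfl | rfl)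
      · exact Or.inr ⟨rfl, min_le_left _ _⟩
      · exact Or.inr ⟨rfl, min_le_right _ _⟩
    · intro z hz
      have hx := hz (Or.inl rfl)
      have hy := hz (Or.inr rfl)
      rcases z with _ | ⟨k, l⟩
      · exact hx.elim
      have hk : k = 0 := by
        rcases hx with ⟨h4, -⟩ | ⟨h4, -⟩
        · rcases hy with ⟨h5, -⟩ | ⟨h5, -⟩
          · exact (h1 (h4.symm.trans h5)).elim
          · exact h5
        · exact h4
      subst hk
      exact Or.inr ⟨rfl, le_min (Below.level_le hx) (Below.level_le hy)⟩

instance : Lattice (Comb σ) where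
  sup x y := join (σ := σ) x y
  inf x y := meet (σ := σ) x y
  le_sup_left x y := (isLUB_join x y).1 (Or.inl rfl)
  le_sup_right x y := (isLUB_join x y).1 (Or.inr rfl)
  sup_le x y z h1 h2 := (isLUB_join x y).2 (by simp [upperBounds, h1, h2])
  inf_le_left x y := (isGLB_meet x y).1 (Or.inl rfl)
  inf_le_right x y := (isGLB_meet x y).1 (Or.inr rfl)
  le_inf x y z h1 h2 := (isGLB_meet y z).2 (by simp [lowerBounds, h1, h2])

instance : BoundedOrder (Comb σ) where

theorem eq_top_or_elem (x : Comb σ) : x = ⊤ ∨ ∃ i m, x = elem σ i m := by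
  rcases x with _ | ⟨i, m⟩
  · exact Or.inl rfl
  · exact Or.inr ⟨i, m, rfl⟩

theorem elem_injective {i m j n : ℕ} : elem σ i m = elem σ j n ↔ i = j ∧ m = n :=
  (Option.some_inj (a := (i, m)) (b := (j, n))).trans (by simp)

theorem inf_eq_elem {i j m n : ℕ} (h : i ≠ j) :
    elem σ i m ⊓ elem σ j n = elem σ 0 (min (level σ i m) (level σ j n)) :=
  if_neg h

theorem sup_eq_max {i m n : ℕ} : elem σ i m ⊔ elem σ i n = elem σ i (max m n) :=
  if_pos rfl

theorem sup_eq_raise {n j m : ℕ} (h : j ≠ 0) :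
    elem σ 0 n ⊔ elem σ j m = (raise σ n j m : Option (ℕ × ℕ)) :=
  (if_neg (Ne.symm h)).trans (if_pos rfl)

theorem sup_eq_top {i j m n : ℕ} (hij : i ≠ j) (hi : i ≠ 0) (hj : j ≠ 0) :
    elem σ i m ⊔ elem σ j n = ⊤ :=
  (if_neg hij).trans ((if_neg hi).trans (if_neg hj))

/-- The lines with index at least `5` contain complements. -/
theorem isCompl_outer {i m j : ℕ} (hj : 5 ≤ j) (hij : i ≠ j) (h0 : elem σ i m ≠ ⊥) :
    IsCompl (elem σ i m) (elem σ j 0) := by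
  have hl : ∀ k, level σ j k = 0 := fun k => by
    simp only [level]; split_ifs <;> omega
  constructor
  · rw [disjoint_iff, inf_eq_elem hij, hl, Nat.min_zero]
    rfl
  · rw [codisjoint_iff]
    by_cases hi : i = 0
    · subst hi
      have hm : ¬ m ≤ 0 := fun hm => h0 (by rw [Nat.le_zero.1 hm]; rfl)
      rw [sup_eq_raise (Ne.symm hij)]
      simp only [raise, hl, hm, if_false]
      rfl
    · exact sup_eq_top hij hi (by omega)

theorem isComplementedLattice (σ : ℕ → Bool) : IsComplementedLattice (Comb σ) := by
  refine ⟨inferInstance, ⟨fun x => ?_⟩⟩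
  rcases eq_top_or_elem x with rfl | ⟨i, m, rfl⟩
  · exact ⟨⊥, isCompl_top_bot⟩
  by_cases h0 : elem σ i m = ⊥
  · exact ⟨⊤, h0 ▸ isCompl_bot_top⟩
  by_cases hi : i = 5
  · exact ⟨_, isCompl_outer (j := 6) (by omega) (by omega) h0⟩
  · exact ⟨_, isCompl_outer (j := 5) le_rfl hi h0⟩

/-- The chain elements `1` and `2` have a common complement on line `5`. -/
theorem isNonDistributive (σ : ℕ → Bool) : IsNonDistributive (Comb σ) := by
  intro h
  have hne : ∀ k : ℕ, k ≠ 0 → IsCompl (elem σ 0 k) (elem σ 5 0) := fun k hk =>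
    isCompl_outer le_rfl (by omega) fun h => hk (elem_injective.1 h).2
  have h1 := h (elem σ 0 2) (elem σ 5 0) (elem σ 0 1)
  rw [(hne 1 one_ne_zero).symm.sup_eq_top, (hne 2 two_ne_zero).inf_eq_bot,
    inf_top_eq, bot_sup_eq] at h1
  have h2 : elem σ 0 2 ⊔ elem σ 0 1 = elem σ 0 1 := sup_eq_right.2 (inf_eq_left.1 h1.symm)
  rw [sup_eq_max, elem_injective] at h2
  omega

/-! #### Generating the chain -/

theorem sup_elem {k j l : ℕ} (hj : j ≠ 0) (h : k ≤ level σ j l)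
    (hmin : ∀ i, k ≤ level σ j i → l ≤ i) : elem σ 0 k ⊔ elem σ j 0 = elem σ j l := by
  obtain ⟨l', hl, hr⟩ := below_raise hj h (Nat.zero_le l)
  have hs := raise_spec hj hr
  rw [sup_eq_raise hj, hr, le_antisymm hl (hmin l' hs.2.2)]
  rfl

theorem level_of_le {j : ℕ} (m : ℕ) (h0 : j ≠ 0) (h : j ≤ 3) : level σ j m = 3 * m + (j - 1) :=
  (if_neg h0).trans (if_pos h)

theorem level_four (m : ℕ) : level σ 4 m = 3 * m + (σ m).toNat := rfl

theorem sup_tooth {k j l : ℕ} (h0 : j ≠ 0) (h3 : j ≤ 3) (h : k ≤ 3 * l + (j - 1))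
    (hl : 3 * l + j < k + 4) : elem σ 0 k ⊔ elem σ j 0 = elem σ j l := by
  refine sup_elem h0 ((level_of_le l h0 h3).symm ▸ h) fun i hi => ?_
  rw [level_of_le i h0 h3] at hi
  omega

/-- The joins of the chain element `k` with the three generators have levels `k`, `k + 1`, `k + 2`
in an order depending on `k` modulo `3`. The term is their median. -/
theorem stepTerm_eq (k : ℕ) : stepTerm (· ⊔ ·) (· ⊓ ·) (elem σ 1 0) (elem σ 2 0) (elem σ 3 0)
    (elem σ 0 k) = elem σ 0 (k + 1) := by
  have h1 := sup_tooth (σ := σ) (k := k) (j := 1) (l := (k + 2) / 3) (by omega) (by omega)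
    (by omega) (by omega)
  have h2 := sup_tooth (σ := σ) (k := k) (j := 2) (l := (k + 1) / 3) (by omega) (by omega)
    (by omega) (by omega)
  have h3 := sup_tooth (σ := σ) (k := k) (j := 3) (l := k / 3) (by omega) (by omega)
    (by omega) (by omega)
  simp only [stepTerm]
  rw [h1, h2, h3, inf_eq_elem (by omega), inf_eq_elem (by omega), inf_eq_elem (by omega),
    sup_eq_max, sup_eq_max, elem_injective, level_of_le _ (by omega) (by omega),
    level_of_le _ (by omega) (by omega), level_of_le _ (by omega) (by omega)]
  omega

/-- The element `n` of line `4` is always above `3 * n` on the chain, and above `3 * n + 1` only if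
`σ n` is true. Otherwise the second join moves on to index `n + 1`. -/
theorem sup_teeth_iff (n : ℕ) : elem σ 0 (3 * n) ⊔ elem σ 4 0 = elem σ 0 (3 * n + 1) ⊔ elem σ 4 0 ↔
    σ n = true := by
  have key : ∀ i, (σ i).toNat ≤ 1 := fun i => Bool.toNat_le _
  rw [sup_elem (k := 3 * n) (l := n) (by omega) (by rw [level_four]; omega) fun i hi => by
    rw [level_four] at hi
    have := key i
    omega]
  cases hn : σ n
  · rw [sup_elem (k := 3 * n + 1) (l := n + 1) (by omega) (by rw [level_four]; omega) fun i hi => by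
      rw [level_four] at hi
      have := key i
      rcases (by omega : n < i ∨ i = n) with h | rfl
      · exact h
      · simp [hn] at hi, elem_injective]
    simp
  · rw [sup_elem (k := 3 * n + 1) (l := n) (by omega) (by rw [level_four, hn]; rfl) fun i hi => by
      rw [level_four] at hi
      have := key i
      omega]
    simp

/-! #### Computability -/

theorem computable_level (hσ : Computable σ) : Computable₂ (level σ) := by
  have h3 : Computable fun p : ℕ × ℕ => 3 * p.2 := Primrec.nat_mul.to_comp.comp (.const 3) .snd
  have h1 : Computable fun p : ℕ × ℕ => 3 * p.2 + (p.1 - 1) :=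
    Primrec.nat_add.to_comp.comp h3 (Primrec.pred.to_comp.comp .fst)
  have h2 : Computable fun p : ℕ × ℕ => 3 * p.2 + (σ p.2).toNat :=
    Primrec.nat_add.to_comp.comp h3 ((Primrec.dom_bool Bool.toNat).to_comp.comp (hσ.comp .snd))
  exact Computable.ite (.eq .fst (.const 0)) .snd (Computable.ite (.nat_le .fst (.const 3)) h1
    (Computable.ite (.eq .fst (.const 4)) h2 (.const 0)))

theorem computable_raise (hσ : Computable σ) {α : Type} [Primcodable α] {n j m : α → ℕ}
    (hn : Computable n) (hj : Computable j) (hm : Computable m) :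
    Computable fun a => raise σ (n a) (j a) (m a) := by
  have h3 : Computable fun a => n a / 3 := Primrec.nat_div.to_comp.comp hn (.const 3)
  have h4 : Computable fun a => n a / 3 + 1 := Computable.succ.comp h3
  have step : ∀ {f : α → ℕ} {g : α → Option (ℕ × ℕ)}, Computable f → Computable g →
      Computable fun a => if n a ≤ level σ (j a) (f a) then some (j a, f a) else g a :=
    fun hf hg => Computable.ite (.nat_le hn ((computable_level hσ).comp hj hf))
      (Computable.option_some.comp (hj.pair hf)) hg
  exact step hm (step h3 (step h4 (.const none)))

theorem computable_sup (hσ : Computable σ) : Computable₂ fun x y : Comb σ => x ⊔ y := by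
  have hi : Computable fun p : (ℕ × ℕ) × (ℕ × ℕ) => p.1.1 := Computable.fst.comp .fst
  have hm : Computable fun p : (ℕ × ℕ) × (ℕ × ℕ) => p.1.2 := Computable.snd.comp .fst
  have hj : Computable fun p : (ℕ × ℕ) × (ℕ × ℕ) => p.2.1 := Computable.fst.comp .snd
  have hn : Computable fun p : (ℕ × ℕ) × (ℕ × ℕ) => p.2.2 := Computable.snd.comp .snd
  have h : Computable fun p : (ℕ × ℕ) × (ℕ × ℕ) =>
      if p.1.1 = p.2.1 then some (p.1.1, max p.1.2 p.2.2) else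
        if p.1.1 = 0 then raise σ p.1.2 p.2.1 p.2.2 else
          if p.2.1 = 0 then raise σ p.2.2 p.1.1 p.1.2 else none :=
    Computable.ite (.eq hi hj)
      (Computable.option_some.comp (hi.pair (Primrec.nat_max.to_comp.comp hm hn)))
      (Computable.ite (.eq hi (.const 0)) (computable_raise hσ hm hj hn)
        (Computable.ite (.eq hj (.const 0)) (computable_raise hσ hn hi hm) (.const none)))
  have : Computable fun p : Option (ℕ × ℕ) × Option (ℕ × ℕ) => join (σ := σ) p.1 p.2 :=
    Computable.option_bind .fst (Computable.option_bind (Computable.snd.comp .fst)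
      (h.comp (Computable.pair (Computable.snd.comp .fst) .snd)).to₂).to₂
  exact this

theorem computable_inf (hσ : Computable σ) : Computable₂ fun x y : Comb σ => x ⊓ y := by
  have hi : Computable fun p : (ℕ × ℕ) × (ℕ × ℕ) => p.1.1 := Computable.fst.comp .fst
  have hm : Computable fun p : (ℕ × ℕ) × (ℕ × ℕ) => p.1.2 := Computable.snd.comp .fst
  have hj : Computable fun p : (ℕ × ℕ) × (ℕ × ℕ) => p.2.1 := Computable.fst.comp .snd
  have hn : Computable fun p : (ℕ × ℕ) × (ℕ × ℕ) => p.2.2 := Computable.snd.comp .snd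
  have h : Computable fun p : (ℕ × ℕ) × (ℕ × ℕ) =>
      if p.1.1 = p.2.1 then some (p.1.1, min p.1.2 p.2.2) else
        some (0, min (level σ p.1.1 p.1.2) (level σ p.2.1 p.2.2)) :=
    Computable.ite (.eq hi hj)
      (Computable.option_some.comp (hi.pair (Primrec.nat_min.to_comp.comp hm hn)))
      (Computable.option_some.comp ((Computable.const 0).pair (Primrec.nat_min.to_comp.comp
        ((computable_level hσ).comp hi hm) ((computable_level hσ).comp hj hn))))
  have : Computable fun p : Option (ℕ × ℕ) × Option (ℕ × ℕ) => meet (σ := σ) p.1 p.2 :=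
    Computable.option_casesOn .fst .snd (Computable.option_casesOn (Computable.snd.comp .fst)
      (Computable.option_some.comp .snd)
      (h.comp (Computable.pair (Computable.snd.comp .fst) .snd)).to₂).to₂
  exact this

end Comb

/-! ### The diagonal comb -/

theorem map_stepTerm {α β : Type*} {sup inf : α → α → α} {sup' inf' : β → β → β} (f : α → β)
    (hs : ∀ x y, f (sup x y) = sup' (f x) (f y)) (hi : ∀ x y, f (inf x y) = inf' (f x) (f y))
    (p q r x : α) :
    f (stepTerm sup inf p q r x) = stepTerm sup' inf' (f p) (f q) (f r) (f x) := by
  simp only [stepTerm, hs, hi]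

/-- The indices of two binary operations, with five parameters. -/
abbrev AlgebraCode : Type := (Code × Code) × ℕ × ℕ × ℕ × ℕ × ℕ

/-- The step term in the algebra of natural numbers with codes `d.1.1` and `d.1.2`. -/
def codeStep (d : AlgebraCode) : ℕ → ℕ :=
  stepTerm (primEval₂ d.1.1) (primEval₂ d.1.2) d.2.1 d.2.2.1 d.2.2.2.1

/-- The `k`-th element of the chain generated in that algebra. -/
def codeChain (d : AlgebraCode) (k : ℕ) : ℕ :=
  k.rec d.2.2.2.2.2 fun _ x => codeStep d x

/-- The join of the `k`-th element of the chain with the last generator. -/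
def codeTooth (d : AlgebraCode) (k : ℕ) : ℕ :=
  primEval₂ d.1.1 (codeChain d k) d.2.2.2.2.1

theorem computable_codeStep : Computable₂ codeStep := by
  have hd : Computable fun a : AlgebraCode × ℕ => a.1 := .fst
  have hc := Computable.fst.comp hd
  have hp := Computable.snd.comp hd
  have hq := Computable.snd.comp hp
  have hr := Computable.snd.comp hq
  have ev : ∀ {e : AlgebraCode × ℕ → Code}
      {f g : AlgebraCode × ℕ → ℕ}, Computable e → Computable f →
      Computable g → Computable fun a => primEval₂ (e a) (f a) (g a) :=
    fun he hf hg => computable_primEval₂.comp (he.pair (hf.pair hg))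
  have hi := Computable.snd.comp hc
  have hs := Computable.fst.comp hc
  have h1 := ev hs .snd (Computable.fst.comp hp)
  have h2 := ev hs .snd (Computable.fst.comp hq)
  have h3 := ev hs .snd (Computable.fst.comp hr)
  exact ev hs (ev hs (ev hi h1 h2) (ev hi h1 h3)) (ev hi h2 h3)

theorem _root_.Computable₂.nat_rec_right {α β : Type*} [Primcodable α] [Primcodable β] {x : α → β}
    {f : α → β → β} (hx : Computable x) (hf : Computable₂ f) :
    Computable₂ fun a k => (Nat.rec (x a) (fun _ => f a) k : β) :=
  Computable.nat_rec (f := fun a : α × ℕ => a.2) (g := fun a => x a.1)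
    (h := fun a b => f a.1 b.2) .snd (hx.comp .fst)
    (hf.comp (Computable.fst.comp .fst) (Computable.snd.comp .snd))

theorem computable_codeChain : Computable₂ codeChain :=
  Computable₂.nat_rec_right (f := codeStep) (Computable.snd.comp (Computable.snd.comp
    (Computable.snd.comp (Computable.snd.comp .snd)))) computable_codeStep

theorem computable_codeTooth : Computable₂ codeTooth := by
  have h0 : Computable fun a : AlgebraCode × ℕ => a.1.1.1 :=
    Computable.fst.comp (Computable.fst.comp .fst)
  have h1 : Computable fun a : AlgebraCode × ℕ => a.1.2.2.2.2.1 :=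
    Computable.fst.comp (Computable.snd.comp (Computable.snd.comp (Computable.snd.comp
      (Computable.snd.comp .fst))))
  have h2 : Computable fun a : AlgebraCode × ℕ => codeChain a.1 a.2 := computable_codeChain
  have h3 := computable_primEval₂.comp (h0.pair (h2.pair h1))
  exact h3

/-- The `n`-th tuple of indices of two operations and five parameters. -/
def algebraRequirement (n : ℕ) : AlgebraCode :=
  (Encodable.decode n).getD ((Code.zero, Code.zero), 0, 0, 0, 0, 0)

theorem computable_algebraRequirement : Computable algebraRequirement :=
  Computable.option_getD Computable.decode (.const _)

/-- The parameter of the diagonal comb. -/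
def diagonalTeeth (n : ℕ) : Bool :=
  !decide (codeTooth (algebraRequirement n) (3 * n) = codeTooth (algebraRequirement n) (3 * n + 1))

/-- The definition evaluates only enumerated total operations, for a number of steps fixed in
advance, and does not refer to the comb. It is therefore not circular, and it halts even on codes
that describe no lattice. -/
theorem computable_diagonalTeeth : Computable diagonalTeeth := by
  have h : Computable fun n : ℕ => 3 * n := Primrec.nat_mul.to_comp.comp (.const 3) .id
  have h1 : Computable fun n => codeTooth (algebraRequirement n) (3 * n) :=
    computable_codeTooth.comp computable_algebraRequirement h
  have h2 : Computable fun n => codeTooth (algebraRequirement n) (3 * n + 1) :=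
    computable_codeTooth.comp computable_algebraRequirement (Computable.succ.comp h)
  exact Primrec.not.to_comp.comp (ComputablePred.eq h1 h2).decide

/-- The diagonal comb has no primitive recursive copy. -/
theorem not_primrec_diagonalComb {g h : ℕ → ℕ → ℕ} (hg : Primrec₂ g) (hh : Primrec₂ h)
    (f : Comb diagonalTeeth ≃ ℕ)
    (hf : ∀ x y, f (x ⊔ y) = g (f x) (f y) ∧ f (x ⊓ y) = h (f x) (f y)) : False := by
  obtain ⟨e, he⟩ := exists_primEval₂_eq hg
  obtain ⟨e', he'⟩ := exists_primEval₂_eq hh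
  have hs : ∀ x y, f (x ⊔ y) = primEval₂ e (f x) (f y) := fun x y => by rw [he, (hf x y).1]
  have hi : ∀ x y, f (x ⊓ y) = primEval₂ e' (f x) (f y) := fun x y => by rw [he', (hf x y).2]
  let d : AlgebraCode :=
    ((e, e'), f (Comb.elem _ 1 0), f (Comb.elem _ 2 0), f (Comb.elem _ 3 0), f (Comb.elem _ 4 0),
      f (Comb.elem _ 0 0))
  obtain ⟨n, hn⟩ : ∃ n, algebraRequirement n = d := ⟨Encodable.encode d, by
    simp only [algebraRequirement, Encodable.encodek, Option.getD_some]⟩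
  -- The isomorphism commutes with the step term, so iterating it in the copy follows the image of
  -- the chain.
  have hchain : ∀ k, codeChain d k = f (Comb.elem _ 0 k) := by
    intro k
    induction k with
    | zero => rfl
    | succ k ih =>
      rw [← Comb.stepTerm_eq, map_stepTerm f hs hi, ← ih]
      rfl
  have htooth : ∀ k, codeTooth d k = f (Comb.elem _ 0 k ⊔ Comb.elem _ 4 0) := by
    intro k
    rw [hs, ← hchain]
    rfl
  -- Equality of the two joins is equivalent to `diagonalTeeth n = true`, which by definition means
  -- that they differ.
  have key := Comb.sup_teeth_iff (σ := diagonalTeeth) n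
  rw [← f.injective.eq_iff, ← htooth, ← htooth, diagonalTeeth, hn] at key
  simp at key

end Punctual

/-! ### The classes of semilattices and lattices -/

namespace Punctual

open FirstOrder FirstOrder.Language FirstOrder.Language.Structure

/-- No class of orders containing the copies of the diagonal tower is punctually robust. -/
theorem not_punctuallyRobust_order {K : (M : Type) → [Language.order.Structure M] → Prop}
    (hK : ∀ (D : Type) [Language.order.Structure D] (e : D ≃ Tower diagonalSchedule),
      (∀ x y, RelMap (leSymb : Language.order.Relations 2) ![x, y] ↔ e x ≤ e y) → K D) :
    ¬ PunctuallyRobust Language.order K := fun h => by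
  obtain ⟨r, hr, f, hf⟩ :=
    h.exists_primrecRel (Tower.computablePred_le computablePred_diagonalSchedule) hK
  exact not_primrecRel_diagonalTower hr f hf

/-- No class of algebras containing the copies of the diagonal tower with its meet operation is
punctually robust. -/
theorem not_punctuallyRobust_semilattice {K : (M : Type) → [semilatticeLang.Structure M] → Prop}
    (hK : ∀ (D : Type) [semilatticeLang.Structure D] (e : D ≃ Tower diagonalSchedule),
      (∀ x y, e (funMap opSymb ![x, y]) = e x ⊓ e y) → K D) :
    ¬ PunctuallyRobust semilatticeLang K := fun h => by
  obtain ⟨g, hg, f, hf⟩ :=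
    h.exists_primrec_op (Tower.computable_inf computablePred_diagonalSchedule) hK
  -- A primitive recursive meet makes the order primitive recursive.
  refine not_primrecRel_diagonalTower (r := fun a b => g a b = a)
    (Primrec.eq.comp hg Primrec.fst) f fun x y => ?_
  rw [← hf, f.injective.eq_iff, inf_eq_left]

/-- No class of algebras containing the copies of the diagonal comb with its join and meet
operations is punctually robust. -/
theorem not_punctuallyRobust_lattice {K : (M : Type) → [latticeLang.Structure M] → Prop}
    (hK : ∀ (D : Type) [latticeLang.Structure D] (e : D ≃ Comb diagonalTeeth),
      (∀ x y, e (funMap joinSymb ![x, y]) = e x ⊔ e y ∧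
        e (funMap meetSymb ![x, y]) = e x ⊓ e y) → K D) :
    ¬ PunctuallyRobust latticeLang K := fun h => by
  obtain ⟨g, k, hg, hk, f, hf⟩ := h.exists_primrec_ops
    (Comb.computable_sup computable_diagonalTeeth) (Comb.computable_inf computable_diagonalTeeth) hK
  exact not_primrec_diagonalComb hg hk f hf

theorem opsAreSupInf_pullback {D A : Type} [Lattice A] [latticeLang.Structure D] (e : D ≃ A)
    (h : ∀ x y, e (funMap joinSymb ![x, y]) = e x ⊔ e y ∧
      e (funMap meetSymb ![x, y]) = e x ⊓ e y) : @OpsAreSupInf D _ e.pullbackLattice :=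
  fun x y => ⟨e.eq_symm_apply.2 (h x y).1, e.eq_symm_apply.2 (h x y).2⟩

end Punctual

theorem corollary1 :
    -- order-theoretic signature `(L, ≤)`
    (¬ Punctual.PunctuallyRobust FirstOrder.Language.order Punctual.OrdJoinSemilattice ∧
     ¬ Punctual.PunctuallyRobust FirstOrder.Language.order Punctual.OrdMeetSemilattice ∧
     ¬ Punctual.PunctuallyRobust FirstOrder.Language.order Punctual.OrdLattice ∧
     ¬ Punctual.PunctuallyRobust FirstOrder.Language.order Punctual.OrdComplementedLattice ∧
     ¬ Punctual.PunctuallyRobust FirstOrder.Language.order Punctual.OrdNonDistributiveLattice) ∧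
    -- algebraic signatures `(L, ∪)`, `(L, ∩)` and `(L, ∪, ∩)`
    (¬ Punctual.PunctuallyRobust Punctual.semilatticeLang Punctual.AlgJoinSemilattice ∧
     ¬ Punctual.PunctuallyRobust Punctual.semilatticeLang Punctual.AlgMeetSemilattice ∧
     ¬ Punctual.PunctuallyRobust Punctual.latticeLang Punctual.AlgLattice ∧
     ¬ Punctual.PunctuallyRobust Punctual.latticeLang Punctual.AlgComplementedLattice ∧
     ¬ Punctual.PunctuallyRobust Punctual.latticeLang Punctual.AlgNonDistributiveLattice) := by
  refine ⟨⟨?_, ?_, ?_, ?_, ?_⟩, ?_, ?_, ?_, ?_, ?_⟩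
  · exact Punctual.not_punctuallyRobust_order fun D _ e h =>
      ⟨e.pullbackLattice.toSemilatticeSup, h⟩
  · exact Punctual.not_punctuallyRobust_order fun D _ e h =>
      ⟨e.pullbackLattice.toSemilatticeInf, h⟩
  · exact Punctual.not_punctuallyRobust_order fun D _ e h => ⟨e.pullbackLattice, h⟩
  · exact Punctual.not_punctuallyRobust_order fun D _ e h => ⟨e.pullbackLattice, h,
      Punctual.isComplementedLattice_pullback e (Punctual.Tower.isComplementedLattice _)⟩
  · exact Punctual.not_punctuallyRobust_order fun D _ e h => ⟨e.pullbackLattice, h,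
      Punctual.isNonDistributive_pullback e (Punctual.Tower.isNonDistributive _)⟩
  · exact Punctual.not_punctuallyRobust_semilattice fun D _ e h =>
      -- The meet of the tower is the join of its order dual.
      ⟨(e.trans OrderDual.toDual).pullbackLattice.toSemilatticeSup,
        fun x y => e.eq_symm_apply.2 (h x y)⟩
  · exact Punctual.not_punctuallyRobust_semilattice fun D _ e h =>
      ⟨e.pullbackLattice.toSemilatticeInf, fun x y => e.eq_symm_apply.2 (h x y)⟩
  · exact Punctual.not_punctuallyRobust_lattice fun D _ e h => ⟨e.pullbackLattice,
      Punctual.opsAreSupInf_pullback e h⟩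
  · exact Punctual.not_punctuallyRobust_lattice fun D _ e h => ⟨e.pullbackLattice,
      Punctual.opsAreSupInf_pullback e h,
      Punctual.isComplementedLattice_pullback e (Punctual.Comb.isComplementedLattice _)⟩
  · exact Punctual.not_punctuallyRobust_lattice fun D _ e h => ⟨e.pullbackLattice,
      Punctual.opsAreSupInf_pullback e h,
      Punctual.isNonDistributive_pullback e (Punctual.Comb.isNonDistributive _)⟩
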